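/- **Setting.** Let $q(\lambda),n(\lambda)$ be polynomially bounded with $n(\lambda)=\omega(\log^2\lambda)$, and for every $\lambda$ let $\mathcal Z(1^\lambda)$ be a probability distribution of pairs $(p,\theta)\in\{0,1\}^{q(\lambda)}\times\{0,1\}^{n(\lambda)}$ (for instance one that is samplable in quantum polynomial time). A *nonuniform QPT algorithm* is a family of quantum channels implemented by polynomial-size quantum circuits (over the gates Hadamard, $T$, CNOT, Toffoli), with ancillas in state $|0\rangle$ and with an advice state of polynomially many qubits, in which all non-output qubits are discarded at the end; this includes uniform QPT algorithms. We say that $\theta$ is *strongly computationally hidden given $p$ with advantage $\eta$* if $\eta(\lambda)$ is negligible and for every nonuniform QPT algorithm $\mathcal D$ with one output bit there is $\lambda_0$ such that for all $\lambda\ge\lambda_0$ $$\bigl|\Pr[\mathcal D_\lambda(p,\theta)=1]-\Pr[\mathcal D_\lambda(p,\theta^*)=1]\bigr|\le\eta(\lambda),$$ where $(p,\theta)\leftarrow\mathcal Z(1^\lambda)$ and $\theta^*\leftarrow\{0,1\}^{n(\lambda)}$ is uniform and independent of $p$. **Game.** Sample $(p,\theta)\leftarrow\mathcal Z(1^\lambda)$.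 A nonuniform QPT algorithm (the preparation phase) gets $p$, but not $\theta$, and creates a state $\rho^{(p)}_{ABC}$, where $A$ and $B$ are registers of $n(\lambda)$ qubits and $C$ is a register of any number of qubits. Then $A$ and $B$ are both measured in the $\theta$-basis $\{H^{\theta_1}|x_1\rangle\otimes\cdots\otimes H^{\theta_n}|x_n\rangle\}_{x\in\{0,1\}^n}$, $n=n(\lambda)$, with outcomes $K_A,K_B\in\{0,1\}^{n(\lambda)}$. If $K_A=K_B$ set $K:=K_A=K_B$, and otherwise let $K\leftarrow\{0,1\}^{n(\lambda)}$ be independent and uniform. Let $\rho_{KC\Theta}$ be the resulting state of $K$, the register $C$ and $\theta$ (stored in a classical register $\Theta$), averaged over $(p,\theta)$, and $\rho_{KC}$ its reduced state. The conditional min-entropy is $$H_{\min}(A|B)_\rho=-\inf_{\sigma_B}\inf\{r\in\mathbb R:\rho_{AB}\le 2^r\, I_A\otimes\sigma_B\},$$ the first infimum being over all density operators $\sigma_B$ on $B$ (and $\inf\emptyset=+\infty$). **Theorem.** There is a positive function $f(m)=\tilde O(2^{-\frac12\sqrt m})$, that is, $f(m)=O(2^{-\frac12\sqrt m}\,|\log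 2^{-\frac12\sqrt m}|^k)$ for some $k$, such that the following holds for all $q$, $n$, $\mathcal Z$ as above and all $\eta$ such that $\theta$ is strongly computationally hidden given $p$ with advantage $\eta$. For every nonuniform QPT preparation phase there exists $\lambda_0$ such that for all $\lambda\ge\lambda_0$ $$H_{\min}(K|C)_\rho\ \ge\ H_{\min}(K|C\Theta)_\rho\ \ge\ -\log_2\bigl(f(n(\lambda))+\eta(\lambda)\bigr).$$ In particular, $H_{\min}(K|C)_\rho=\omega(\log\lambda)$. -/

import Mathlib

open Filter Asymptotics Matrix
open scoped Kronecker Topology ComplexOrder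

noncomputable section

namespace CompMoE

/-! ### Qubit registers

A register is a finite type `W` of qubits (wires). Its computational basis is indexed by the
bit strings `W → Bool`, so operators on it are matrices over `W → Bool`. -/

/-- The bit strings labelling the computational basis of a register with wires `W`. -/
abbrev Bits (W : Type) : Type := W → Bool

/-- Operators on a register with wires `W`. -/
abbrev QOp (W : Type) : Type := Matrix (Bits W) (Bits W) ℂ

/-- Density operators: positive semidefinite with trace one. -/
def IsDensity {X : Type} [Fintype X] (ρ : Matrix X X ℂ) : Prop :=
  ρ.PosSemidef ∧ ρ.trace = 1

/-- The diagonal (classical) state of a random variable with distribution `μ`. -/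
def classicalState {X : Type} [DecidableEq X] (μ : PMF X) : Matrix X X ℂ :=
  Matrix.diagonal fun x => (((μ x).toReal : ℝ) : ℂ)

/-- The one-qubit Hadamard matrix. -/
def hadMatrix : Matrix Bool Bool ℂ :=
  Matrix.of fun a b => ((1 / Real.sqrt 2 : ℝ) : ℂ) * (if a && b then -1 else 1)

/-! ### Quantum circuits -/

/-- Gates on the wires `W`, from the universal gate set Hadamard, `T`, CNOT, Toffoli. -/
inductive Gate (W : Type) : Type
  /-- Hadamard gate on wire `i`. -/
  | had (i : W) : Gate W
  /-- `T = diag(1, exp(iπ/4))` on wire `i`. -/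
  | tee (i : W) : Gate W
  /-- Controlled NOT with control `a` and target `t`. -/
  | cnot (a t : W) (h : a ≠ t) : Gate W
  /-- Toffoli gate with controls `a`, `b` and target `t`. -/
  | toffoli (a b t : W) (hab : a ≠ b) (hat : a ≠ t) (hbt : b ≠ t) : Gate W

/-- The unitary of a gate, acting as the identity on all other wires. -/
def Gate.toMatrix {W : Type} [Fintype W] [DecidableEq W] : Gate W → QOp W
  | .had i => Matrix.of fun x y =>
      if ∀ j, j ≠ i → x j = y j then hadMatrix (x i) (y i) else 0
  | .tee i => Matrix.diagonal fun x =>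
      if x i then Complex.exp (Complex.I * (Real.pi / 4)) else 1
  | .cnot a t _ => Matrix.of fun x y =>
      if x = Function.update y t (xor (y t) (y a)) then 1 else 0
  | .toffoli a b t _ _ _ => Matrix.of fun x y =>
      if x = Function.update y t (xor (y t) (y a && y b)) then 1 else 0

/-- The unitary of a circuit (a list of gates, the head of the list is applied first). -/
def circuitMatrix {W : Type} [Fintype W] [DecidableEq W] : List (Gate W) → QOp W
  | [] => 1
  | g :: gs => circuitMatrix gs * g.toMatrix

/-- A function is polynomially bounded. -/
def PolyBounded (f : ℕ → ℕ) : Prop :=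
  ∃ P : Polynomial ℕ, ∀ l, f l ≤ P.eval l

/-- A nonuniform QPT algorithm with input registers `In l` and output registers `Out l`: for every
security parameter `l` a quantum circuit, of polynomial size, which acts on the input wires, on
`adv l` wires holding a quantum advice state, and on `anc l` ancillas prepared in the state `0`.
At the end all wires but the output wires are discarded. (Randomness, intermediate measurements
and classical control are obtained as usual with ancillas, by deferring measurements.
A uniform QPT algorithm is the special case without advice in which the circuits are generated
by a classical algorithm.) -/
structure QPT (In Out : ℕ → Type) [∀ l, Fintype (In l)] [∀ l, DecidableEq (In l)] where
  /-- number of advice qubits -/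
  adv : ℕ → ℕ
  /-- number of ancilla qubits -/
  anc : ℕ → ℕ
  /-- number of qubits discarded at the end -/
  disc : ℕ → ℕ
  /-- the advice state -/
  advice : ∀ l, QOp (Fin (adv l))
  advice_density : ∀ l, IsDensity (advice l)
  /-- the circuit -/
  circuit : ∀ l, List (Gate (In l ⊕ (Fin (adv l) ⊕ Fin (anc l))))
  /-- which wires are output and which are discarded -/
  split : ∀ l, (In l ⊕ (Fin (adv l) ⊕ Fin (anc l))) ≃ (Out l ⊕ Fin (disc l))
  wires_poly : PolyBounded fun l => Fintype.card (In l) + adv l + anc l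
  size_poly : PolyBounded fun l => (circuit l).length

section Run

variable {In Out : ℕ → Type} [∀ l, Fintype (In l)] [∀ l, DecidableEq (In l)]

/-- The initial state: input, advice, and ancillas in the state `0`. -/
def QPT.initial (A : QPT In Out) (l : ℕ) (ρ : QOp (In l)) :
    QOp (In l ⊕ (Fin (A.adv l) ⊕ Fin (A.anc l))) :=
  Matrix.of fun x y =>
    ρ (fun i => x (.inl i)) (fun i => y (.inl i)) *
    A.advice l (fun i => x (.inr (.inl i))) (fun i => y (.inr (.inl i))) *
    (if (∀ i, x (.inr (.inr i)) = false) ∧ (∀ i, y (.inr (.inr i)) = false) then 1 else 0)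

/-- The quantum channel implemented by the algorithm at security parameter `l`: prepare advice and
ancillas, apply the circuit, trace out the discarded wires. -/
def QPT.run (A : QPT In Out) (l : ℕ) (ρ : QOp (In l)) : QOp (Out l) :=
  let U := circuitMatrix (A.circuit l)
  let τ := U * A.initial l ρ * Uᴴ
  Matrix.of fun x y => ∑ d : Bits (Fin (A.disc l)),
    τ (fun w => Sum.elim x d (A.split l w)) (fun w => Sum.elim y d (A.split l w))

end Run

/-! ### Computational indistinguishability -/

/-- Nonuniform QPT distinguishers: the output is a single bit. -/
abbrev Distinguisher (In : ℕ → Type) [∀ l, Fintype (In l)] [∀ l, DecidableEq (In l)] : Type :=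
  QPT In (fun _ => Unit)

/-- The probability that the distinguisher outputs `1` on the state `ρ`. -/
def Distinguisher.prOne {In : ℕ → Type} [∀ l, Fintype (In l)] [∀ l, DecidableEq (In l)]
    (D : Distinguisher In) (l : ℕ) (ρ : QOp (In l)) : ℝ :=
  (QPT.run D l ρ (fun _ => true) (fun _ => true)).re

/-- `η` is negligible: `η(l) = l^{-ω(1)}`. -/
def Negligible (η : ℕ → ℝ) : Prop :=
  SuperpolynomialDecay atTop (fun l : ℕ => (l : ℝ)) η

/-- Strong computational indistinguishability with the negligible function `η`: one and the same
`η` eventually bounds the advantage of every nonuniform QPT distinguisher. -/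
def StronglyIndistinguishable {In : ℕ → Type} [∀ l, Fintype (In l)] [∀ l, DecidableEq (In l)]
    (ρ σ : ∀ l, QOp (In l)) (η : ℕ → ℝ) : Prop :=
  Negligible η ∧ ∀ D : Distinguisher In, ∃ l₀ : ℕ, ∀ l ≥ l₀,
    |D.prOne l (ρ l) - D.prOne l (σ l)| ≤ η l

/-- The state of a pair of registers holding a pair of random bit strings. -/
def pairState {q n : ℕ} (μ : PMF (Bits (Fin q) × Bits (Fin n))) : QOp (Fin q ⊕ Fin n) :=
  classicalState (μ.map fun x => Sum.elim x.1 x.2)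

/-- The distribution of `(p, θ*)`, where `p` is the first component of a sample of `μ`, and `θ*`
is uniform and independent of `p`. -/
def idealize {q n : ℕ} (μ : PMF (Bits (Fin q) × Bits (Fin n))) :
    PMF (Bits (Fin q) × Bits (Fin n)) :=
  μ.bind fun x => (PMF.uniformOfFintype (Bits (Fin n))).map fun θ => (x.1, θ)

/-- `θ` is strongly computationally hidden given `p`, with advantage `η`. -/
def StronglyHidden {q n : ℕ → ℕ} (Z : ∀ l, PMF (Bits (Fin (q l)) × Bits (Fin (n l))))
    (η : ℕ → ℝ) : Prop :=
  StronglyIndistinguishable (In := fun l => Fin (q l) ⊕ Fin (n l))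
    (fun l => pairState (Z l)) (fun l => pairState (idealize (Z l))) η

/-! ### Conditional min-entropy -/

/-- `D_∞(α ‖ β) = inf {r ∈ ℝ : α ≤ 2^r β}`, with value `⊤` if there is no such `r`. -/
def maxDivergence {X : Type} [Fintype X] (α β : Matrix X X ℂ) : EReal :=
  ⨅ (r : ℝ) (_ : ((((2 : ℝ) ^ r : ℝ) : ℂ) • β - α).PosSemidef), (r : EReal)

/-- Conditional min-entropy `H_min(A|B)_ρ = - inf_σ D_∞(ρ_AB ‖ I_A ⊗ σ_B)`, the infimum being over
all density operators on `B`. -/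
def condMinEntropy {A B : Type} [Fintype A] [DecidableEq A] [Fintype B]
    (ρ : Matrix (A × B) (A × B) ℂ) : EReal :=
  -(⨅ (σ : Matrix B B ℂ) (_ : IsDensity σ), maxDivergence ρ ((1 : Matrix A A ℂ) ⊗ₖ σ))

/-! ### The game -/

/-- The vector `|x⟩_θ = H^θ |x⟩` of the `θ`-basis. -/
def basisKet {n : ℕ} (θ x : Bits (Fin n)) : Bits (Fin n) → ℂ :=
  fun y => ∏ i, (if θ i then hadMatrix else 1) (y i) (x i)

/-- The registers `A`, `B` (of `n` qubits each) and `C` (of `c` qubits). -/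
abbrev ABC (n c : ℕ) : Type := Fin n ⊕ (Fin n ⊕ Fin c)

/-- The unnormalized state of `C` after measuring `A` and `B` in the `θ`-basis with outcomes `kA`
and `kB`: `Tr_AB ((|kA kB⟩⟨kA kB|_θ ⊗ I_C) ρ)`. -/
def postState {n c : ℕ} (ρ : QOp (ABC n c)) (θ kA kB : Bits (Fin n)) : QOp (Fin c) :=
  Matrix.of fun z z' => ∑ a, ∑ b, ∑ a', ∑ b',
    star (basisKet θ kA a * basisKet θ kB b) *
      ρ (Sum.elim a (Sum.elim b z)) (Sum.elim a' (Sum.elim b' z')) *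
      (basisKet θ kA a' * basisKet θ kB b')

/-- The state of `K` given the outcomes: `K = kA` if `kA = kB`, and `K` uniform otherwise. -/
def keyState {n : ℕ} (kA kB : Bits (Fin n)) : QOp (Fin n) :=
  if kA = kB then Matrix.single kA kA 1 else ((2 : ℂ) ^ n)⁻¹ • (1 : QOp (Fin n))

/-- The state `ρ_{KCΘ}` at the end of the question phase, for `(p, θ)` sampled from `μ`, when the
preparation phase creates the state `ρ p` on input `p`. -/
def stateKCT {q n c : ℕ} (μ : PMF (Bits (Fin q) × Bits (Fin n)))
    (ρ : Bits (Fin q) → QOp (ABC n c)) :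
    Matrix (Bits (Fin n) × (Bits (Fin c) × Bits (Fin n)))
      (Bits (Fin n) × (Bits (Fin c) × Bits (Fin n))) ℂ :=
  ∑ x : Bits (Fin q) × Bits (Fin n), (((μ x).toReal : ℝ) : ℂ) •
    ∑ kA, ∑ kB, keyState kA kB ⊗ₖ
      (postState (ρ x.1) x.2 kA kB ⊗ₖ (Matrix.single x.2 x.2 1 : QOp (Fin n)))

/-- The reduced state on the first two of three systems. -/
def traceOutLast {X Y T : Type} [Fintype T] (ρ : Matrix (X × (Y × T)) (X × (Y × T)) ℂ) :
    Matrix (X × Y) (X × Y) ℂ :=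
  Matrix.of fun x y => ∑ t, ρ (x.1, (x.2, t)) (y.1, (y.2, t))

/-- A (nonuniform) QPT algorithm for the preparation phase: input `p`, output registers `A, B, C`. -/
abbrev Preparation (q n c : ℕ → ℕ) : Type :=
  QPT (fun l => Fin (q l)) (fun l => ABC (n l) (c l))

/-- The state `ρ_{ABC}^{(p)}` created by the preparation phase on input `p`. -/
def Preparation.state {q n c : ℕ → ℕ} (prep : Preparation q n c) (l : ℕ)
    (p : Bits (Fin (q l))) : QOp (ABC (n l) (c l)) :=
  QPT.run prep l (Matrix.single p p 1)

/-- `ρ_{KCΘ}` for the game at security parameter `l`. -/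
def gameKCT {q n c : ℕ → ℕ} (Z : ∀ l, PMF (Bits (Fin (q l)) × Bits (Fin (n l))))
    (prep : Preparation q n c) (l : ℕ) :
    Matrix (Bits (Fin (n l)) × (Bits (Fin (c l)) × Bits (Fin (n l))))
      (Bits (Fin (n l)) × (Bits (Fin (c l)) × Bits (Fin (n l)))) ℂ :=
  stateKCT (Z l) (prep.state l)

/-- `ρ_{KC}` for the game at security parameter `l`. -/
def gameKC {q n c : ℕ → ℕ} (Z : ∀ l, PMF (Bits (Fin (q l)) × Bits (Fin (n l))))
    (prep : Preparation q n c) (l : ℕ) :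
    Matrix (Bits (Fin (n l)) × Bits (Fin (c l))) (Bits (Fin (n l)) × Bits (Fin (c l))) ℂ :=
  traceOutLast (gameKCT Z prep l)

/-- `f = Õ(g)`: `f = O(g · |log g|^k)` for some `k`. -/
def IsSoftO (f g : ℕ → ℝ) : Prop :=
  ∃ k : ℕ, f =O[atTop] fun m => g m * |Real.log (g m)| ^ k

end CompMoE

end

/-!
The state prepared in the game is regarded in the Bell basis of the qubit pairs `(A_i, B_i)`. Such a
basis vector carries a bit error and a phase error at every position `i`, and equal outcomes in the
`θ`-basis exclude a bit error where `θ_i = 0` and a phase error where `θ_i = 1`: the error pattern is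
*consistent* with `θ`. The positions contain `⌊√n⌋` disjoint blocks of length `⌊√n⌋`, and the
consistent part of the state is split according to whether every block contains an error.

*Every block contains an error.* Passing the test "consistent with `θ` and an error in every block"
requires guessing at least one bit of `θ` in each block, so for uniform `θ` its probability is at
most `2^{-⌊√n⌋}` (`sum_testProb_le`). Given `p` and `θ`, the test is carried out by a polynomial-size
circuit: the preparation, the Bell measurement, and a reversible evaluation of a Boolean formula
(`exists_test_distinguisher`). As `θ` is hidden given `p`, the probability in the game is thus at
most `2^{-⌊√n⌋} + η` (`eventually_testProb_le`).

*Some block is error-free.* There both halves of the block are maximally entangled, and a fixed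
outcome in the `θ`-basis has a small amplitude: the component of such a product vector on the span of
these Bell states has squared norm at most `⌊√n⌋ 2^{-⌊√n⌋}` (`sum_bellAmp_sq_le`).

A Cauchy-Schwarz inequality with weights `1 + t²` and `1 + t⁻²` combines both parts and bounds
`ρ_{KCΘ}` by `I ⊗ ω` with a positive `ω` of trace at most
`(1 + t²) (2^{-⌊√n⌋} + η) + (1 + t⁻²) ⌊√n⌋ 2^{-⌊√n⌋} + 2^{-n}`, where the last term comes from unequal
outcomes (`exists_stateKCT_le`). With `t² = 2^{-⌊√n⌋/2}` this is at most
`(8 + 4 √n) 2^{-√n/2} + η` (`trace_bound_le`); the operator inequality is a bound for the conditional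
min-entropy (`le_condMinEntropy`), and discarding `Θ` does not decrease that entropy
(`condMinEntropy_le_traceOutLast`). The register `C` is never measured, so only the error test has
to be efficient.
-/

noncomputable section

namespace CompMoE

/-! ### Compressing one tensor factor onto a vector -/

section Slice

variable {X Z : Type} [Fintype X] [DecidableEq X] [Fintype Z] [DecidableEq Z]

/-- The operator `|u⟩ ⊗ I_Z` from `Z` to `X ⊗ Z`. -/
def ketOp (u : X → ℂ) : Matrix (X × Z) Z ℂ :=
  Matrix.of fun x z => if x.2 = z then u x.1 else 0

/-- The compression `(⟨u| ⊗ I_Z) ρ (|u⟩ ⊗ I_Z)`: the unnormalized state of `Z` after the outcome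
`|u⟩⟨u|` on `X`. -/
def slice (ρ : Matrix (X × Z) (X × Z) ℂ) (u : X → ℂ) : Matrix Z Z ℂ :=
  (ketOp u : Matrix (X × Z) Z ℂ)ᴴ * ρ * (ketOp u : Matrix (X × Z) Z ℂ)

/-- The partial trace over the first factor. -/
def traceOutFirst (ρ : Matrix (X × Z) (X × Z) ℂ) : Matrix Z Z ℂ :=
  Matrix.of fun z z' => ∑ x, ρ (x, z) (x, z')

omit [DecidableEq X] in
theorem slice_apply (ρ : Matrix (X × Z) (X × Z) ℂ) (u : X → ℂ) (z z' : Z) :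
    slice ρ u z z' = ∑ x, ∑ x', star (u x) * ρ (x, z) (x', z') * u x' := by
  simp only [slice, Matrix.mul_apply, ketOp, conjTranspose_apply, Matrix.of_apply,
    Fintype.sum_prod_type, mul_ite, mul_zero, Finset.sum_ite_eq', Finset.mem_univ, if_true,
    apply_ite star, star_zero, ite_mul, zero_mul, Finset.sum_mul]
  rw [Finset.sum_comm]

omit [DecidableEq X] in
theorem slice_posSemidef {ρ : Matrix (X × Z) (X × Z) ℂ} (hρ : ρ.PosSemidef) (u : X → ℂ) :
    (slice ρ u).PosSemidef :=
  hρ.conjTranspose_mul_mul_same _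

omit [Fintype X] [DecidableEq X] [Fintype Z] in
theorem ketOp_add (u v : X → ℂ) : (ketOp (u + v) : Matrix (X × Z) Z ℂ) = ketOp u + ketOp v := by
  ext x z
  by_cases h : x.2 = z <;> simp [ketOp, h]

omit [DecidableEq Z] in
/-- The weighted Cauchy-Schwarz inequality for operators: cross terms are absorbed at the price of
unequal weights on the two diagonal terms. -/
theorem posSemidef_weighted_cauchySchwarz {Y : Type} [Fintype Y] {ρ : Matrix Y Y ℂ} (hρ : ρ.PosSemidef)
    (E F : Matrix Y Z ℂ) {t : ℝ} (ht : 0 < t) :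
    (((1 + t ^ 2 : ℝ) : ℂ) • (Eᴴ * ρ * E) + ((1 + (t ^ 2)⁻¹ : ℝ) : ℂ) • (Fᴴ * ρ * F)
      - (E + F)ᴴ * ρ * (E + F)).PosSemidef := by
  have h := hρ.conjTranspose_mul_mul_same ((t : ℂ) • E - ((t⁻¹ : ℝ) : ℂ) • F)
  convert h using 1
  have ht' : (t : ℂ) ≠ 0 := by exact_mod_cast ht.ne'
  simp only [conjTranspose_add, conjTranspose_sub, conjTranspose_smul, Matrix.add_mul,
    Matrix.mul_add, Matrix.sub_mul, Matrix.mul_sub, Matrix.smul_mul, Matrix.mul_smul, smul_smul,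
    smul_sub, Complex.star_def, Complex.conj_ofReal]
  push_cast
  have e1 : (t : ℂ) * t = t ^ 2 := by ring
  have e2 : (t : ℂ)⁻¹ * (t : ℂ)⁻¹ = (t ^ 2 : ℂ)⁻¹ := by field_simp
  simp only [e1, e2, mul_inv_cancel₀ ht', inv_mul_cancel₀ ht']
  module

omit [DecidableEq X] in
theorem slice_add_le {ρ : Matrix (X × Z) (X × Z) ℂ} (hρ : ρ.PosSemidef) (u v : X → ℂ) {t : ℝ}
    (ht : 0 < t) :
    (((1 + t ^ 2 : ℝ) : ℂ) • slice ρ u + ((1 + (t ^ 2)⁻¹ : ℝ) : ℂ) • slice ρ v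
      - slice ρ (u + v)).PosSemidef := by
  unfold slice
  rw [ketOp_add]
  exact posSemidef_weighted_cauchySchwarz hρ _ _ ht

theorem slice_single (ρ : Matrix (X × Z) (X × Z) ℂ) (x : X) (a : ℂ) (z z' : Z) :
    slice ρ (Pi.single x a) z z' = star a * ρ (x, z) (x, z') * a := by
  rw [slice_apply, Finset.sum_eq_single x, Finset.sum_eq_single x]
  · simp
  · intro y _ hy
    simp [hy]
  · simp
  · intro y _ hy
    simp [hy]
  · simp

theorem traceOutFirst_posSemidef {ρ : Matrix (X × Z) (X × Z) ℂ} (hρ : ρ.PosSemidef) :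
    (traceOutFirst ρ).PosSemidef := by
  have : traceOutFirst ρ = ∑ x, slice ρ (Pi.single x 1) := by
    ext z z'
    simp [Matrix.sum_apply, slice_single, traceOutFirst]
  rw [this]
  exact posSemidef_sum _ fun x _ => slice_posSemidef hρ _

omit [DecidableEq X] [DecidableEq Z] in
theorem trace_traceOutFirst (ρ : Matrix (X × Z) (X × Z) ℂ) :
    (traceOutFirst ρ).trace = ρ.trace := by
  simp only [Matrix.trace, traceOutFirst, Matrix.of_apply, diag_apply, Fintype.sum_prod_type]
  exact Finset.sum_comm

/-- Since `|u⟩⟨u| ≤ ‖u‖² I`, the compression onto `u` is at most `‖u‖²` times the partial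
trace. The difference is a sum of compressions, by the Lagrange identity. -/
theorem slice_le_traceOutFirst {ρ : Matrix (X × Z) (X × Z) ℂ} (hρ : ρ.PosSemidef) (u : X → ℂ) :
    ((∑ x, star (u x) * u x) • traceOutFirst ρ - slice ρ u).PosSemidef := by
  have h : ((1 / 2 : ℝ) • ∑ x, ∑ y, slice ρ
      (Pi.single x (star (u y)) - Pi.single y (star (u x)))).PosSemidef :=
    (posSemidef_sum _ fun x _ => posSemidef_sum _ fun y _ => slice_posSemidef hρ _).smul
      (by norm_num)
  convert h using 1
  ext z z'
  have key : ∀ x y, slice ρ (Pi.single x (star (u y)) - Pi.single y (star (u x))) z z' =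
      star (u y) * u y * ρ (x, z) (x, z') + star (u x) * u x * ρ (y, z) (y, z')
        - star (u x) * ρ (x, z) (y, z') * u y - star (u y) * ρ (y, z) (x, z') * u x := by
    intro x y
    rw [slice_apply]
    simp only [Pi.sub_apply, star_sub, Pi.single_apply, sub_mul, mul_sub, Finset.sum_sub_distrib,
      apply_ite star, star_zero, star_star, ite_mul, mul_ite, zero_mul, mul_zero,
      Finset.sum_ite_eq', Finset.mem_univ, if_true]
    ring
  simp only [Matrix.sub_apply, Matrix.smul_apply, Matrix.sum_apply, key, Finset.sum_add_distrib,
    Finset.sum_sub_distrib, slice_apply, traceOutFirst, Matrix.of_apply, smul_eq_mul]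
  have e1 : ∑ x, ∑ y, star (u y) * u y * ρ (x, z) (x, z') =
      (∑ x, star (u x) * u x) * ∑ x, ρ (x, z) (x, z') := by
    rw [Finset.sum_comm, Finset.sum_mul_sum]
  have e2 : ∑ x, ∑ y, star (u x) * u x * ρ (y, z) (y, z') =
      (∑ x, star (u x) * u x) * ∑ x, ρ (x, z) (x, z') := by
    rw [Finset.sum_mul_sum]
  have e3 : ∑ x, ∑ y, star (u y) * ρ (y, z) (x, z') * u x =
      ∑ x, ∑ y, star (u x) * ρ (x, z) (y, z') * u y := Finset.sum_comm
  rw [e1, e2, e3, Complex.real_smul]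
  push_cast
  ring

end Slice

/-! ### Circuits -/

section Circuits

variable {W W' : Type} [Fintype W] [DecidableEq W] [Fintype W'] [DecidableEq W']

theorem circuitMatrix_append (L M : List (Gate W)) :
    circuitMatrix (L ++ M) = circuitMatrix M * circuitMatrix L := by
  induction L with
  | nil => simp [circuitMatrix]
  | cons g L ih => simp [circuitMatrix, ih, Matrix.mul_assoc]

/-- The operator which sends each computational basis vector `|y⟩` to `|F y⟩`. -/
def basisMap {X Y : Type} [DecidableEq X] (F : Y → X) : Matrix X Y ℂ :=
  Matrix.of fun x y => if x = F y then 1 else 0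

theorem basisMap_mul {X Y T : Type} [DecidableEq X] [Fintype Y] [DecidableEq Y] (F : Y → X)
    (G : T → Y) : basisMap F * basisMap G = basisMap (F ∘ G) := by
  ext x y
  simp [basisMap, Matrix.mul_apply]

theorem basisMap_mul_apply {X Y T : Type} [DecidableEq X] [Fintype Y] (F : Y → X)
    (hF : Function.Injective F) (M : Matrix Y T ℂ) (y : Y) (t : T) :
    (basisMap F * M) (F y) t = M y t := by
  classical
  simp [basisMap, Matrix.mul_apply, hF.eq_iff]

theorem basisMap_mul_apply_of_notMem {X Y T : Type} [DecidableEq X] [Fintype Y] (F : Y → X)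
    (M : Matrix Y T ℂ) {x : X} (hx : x ∉ Set.range F) (t : T) : (basisMap F * M) x t = 0 := by
  rw [Matrix.mul_apply]
  apply Finset.sum_eq_zero
  intro y _
  rw [basisMap, Matrix.of_apply, if_neg (fun h => hx ⟨y, h.symm⟩), zero_mul]

theorem conjTranspose_basisMap_mul_apply {X Y : Type} [Fintype X] [DecidableEq X] (F : Y → X)
    (y y' : Y) : ((basisMap F)ᴴ * basisMap F) y y' = if F y = F y' then 1 else 0 := by
  simp [basisMap, Matrix.mul_apply, conjTranspose_apply, apply_ite star, eq_comm]

/-- Compressing along `basisMap F` reads off the matrix entries at the images of `F`. -/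
theorem conjTranspose_basisMap_mul_mul {X Y : Type} [Fintype X] [DecidableEq X] (F : Y → X)
    (M : Matrix X X ℂ) : (basisMap F)ᴴ * M * basisMap F = M.submatrix F F := by
  ext y y'
  simp [basisMap, Matrix.mul_apply, conjTranspose_apply, apply_ite star]

/-- The diagonal of a state transported along an injection of basis vectors. -/
theorem sum_basisMap_conj_diag {X Y : Type} [Fintype X] [DecidableEq X] [Fintype Y]
    (F : Y → X) (hF : Function.Injective F) (g : X → ℂ) (M : Matrix Y Y ℂ) :
    ∑ x, g x * (basisMap F * M * (basisMap F)ᴴ) x x = ∑ y, g (F y) * M y y := by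
  symm
  apply Fintype.sum_of_injective F hF
  · intro x hx
    rw [Matrix.mul_assoc, basisMap_mul_apply_of_notMem F _ hx, mul_zero]
  · intro y
    rw [Matrix.mul_assoc, basisMap_mul_apply F hF]
    classical
    simp [basisMap, Matrix.mul_apply, conjTranspose_apply, apply_ite star, hF.eq_iff]

theorem sum_eq_sum_update (i : W) (x : Bits W) (F : Bits W → ℂ)
    (hF : ∀ z, ¬ (∀ j, j ≠ i → z j = x j) → F z = 0) :
    ∑ z, F z = ∑ b, F (Function.update x i b) := by
  symm
  apply Fintype.sum_of_injective (fun b => Function.update x i b)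
  · exact Function.update_injective x i
  · intro z hz
    apply hF
    intro h
    apply hz
    refine ⟨z i, ?_⟩
    ext j
    by_cases hj : j = i
    · subst hj; simp
    · simp [hj, h j hj]
  · intro b; rfl

theorem hadMatrix_isometry (a b : Bool) :
    ∑ t, star (hadMatrix t a) * hadMatrix t b = if a = b then 1 else 0 := by
  have h : ((Real.sqrt 2 : ℝ) : ℂ)⁻¹ * ((Real.sqrt 2 : ℝ) : ℂ)⁻¹ = 1 / 2 := by
    rw [← mul_inv, ← Complex.ofReal_mul, Real.mul_self_sqrt (by norm_num)]
    norm_num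
  cases a <;> cases b <;> (simp [hadMatrix, h]; try norm_num)

theorem Gate.isometry (g : Gate W) : g.toMatrixᴴ * g.toMatrix = 1 := by
  cases g with
  | had i =>
    ext x y
    simp only [Matrix.mul_apply, conjTranspose_apply, Gate.toMatrix, Matrix.of_apply]
    rw [sum_eq_sum_update i x]
    · by_cases hxy : ∀ j, j ≠ i → x j = y j
      · have h1 : ∀ b, (∀ j, j ≠ i → Function.update x i b j = x j) := by
          intro b j hj
          simp [hj]
        have h2 : ∀ b, (∀ j, j ≠ i → Function.update x i b j = y j) := by
          intro b j hj
          simp [hj, hxy j hj]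
        simp only [if_pos (h1 _), if_pos (h2 _), Function.update_self, hadMatrix_isometry,
          Matrix.one_apply]
        congr 1
        apply propext
        constructor
        · intro h
          ext j
          by_cases hj : j = i
          · subst hj; exact h
          · exact hxy j hj
        · rintro rfl; rfl
      · rw [Matrix.one_apply_ne (by rintro rfl; exact hxy fun _ _ => rfl)]
        apply Finset.sum_eq_zero
        intro b _
        rw [if_neg (c := ∀ j, j ≠ i → Function.update x i b j = y j), mul_zero]
        intro h
        apply hxy
        intro j hj
        rw [← h j hj]
        simp [hj]
    · intro z hz
      rw [if_neg hz]
      simp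
  | tee i =>
    ext x y
    have h : ∀ b : Bool, star (if b then Complex.exp (Complex.I * (Real.pi / 4)) else 1) *
        (if b then Complex.exp (Complex.I * (Real.pi / 4)) else 1) = 1 := by
      intro b
      cases b
      · simp
      · simp only [if_true, Complex.star_def]
        rw [← Complex.exp_conj, ← Complex.exp_add]
        have : (starRingEnd ℂ) (Complex.I * (Real.pi / 4)) = -(Complex.I * (Real.pi / 4)) := by
          rw [map_mul, Complex.conj_I, map_div₀, Complex.conj_ofReal,
            show (starRingEnd ℂ) 4 = 4 from Complex.conj_ofNat 4, neg_mul]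
        rw [this, neg_add_cancel, Complex.exp_zero]
    simp only [Gate.toMatrix, diagonal_conjTranspose, diagonal_mul_diagonal, Pi.star_apply, h]
    simp
  | cnot a t hat =>
    change (basisMap _)ᴴ * basisMap _ = 1
    ext x y
    rw [conjTranspose_basisMap_mul_apply, Matrix.one_apply]
    congr 1
    apply propext
    constructor
    · intro h
      have ha := congrFun h a
      simp only [ne_eq, hat, not_false_eq_true, Function.update_of_ne] at ha
      ext j
      have hj := congrFun h j
      by_cases hjt : j = t
      · subst hjt
        simpa [ha] using hj
      · simpa [hjt] using hj
    · rintro rfl; rfl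
  | toffoli a b t hab hat hbt =>
    change (basisMap _)ᴴ * basisMap _ = 1
    ext x y
    rw [conjTranspose_basisMap_mul_apply, Matrix.one_apply]
    congr 1
    apply propext
    constructor
    · intro h
      have ha := congrFun h a
      have hb := congrFun h b
      simp only [ne_eq, hat, hbt, not_false_eq_true, Function.update_of_ne] at ha hb
      ext j
      have hj := congrFun h j
      by_cases hjt : j = t
      · subst hjt
        simpa [ha, hb] using hj
      · simpa [hjt] using hj
    · rintro rfl; rfl

theorem circuitMatrix_isometry (L : List (Gate W)) :
    (circuitMatrix L)ᴴ * circuitMatrix L = 1 := by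
  induction L with
  | nil => simp [circuitMatrix]
  | cons g L ih =>
    simp only [circuitMatrix, conjTranspose_mul]
    rw [Matrix.mul_assoc, ← Matrix.mul_assoc _ (circuitMatrix L), ih, Matrix.one_mul, g.isometry]

/-- Relabel the wires of a gate along an embedding into a larger register. -/
def Gate.map (f : W ↪ W') : Gate W → Gate W'
  | .had i => .had (f i)
  | .tee i => .tee (f i)
  | .cnot a t h => .cnot (f a) (f t) (f.injective.ne h)
  | .toffoli a b t h₁ h₂ h₃ =>
      .toffoli (f a) (f b) (f t) (f.injective.ne h₁) (f.injective.ne h₂) (f.injective.ne h₃)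

/-- Two bit strings agree on the wires outside the range of `f`. -/
def AgreeOff (f : W ↪ W') (x y : Bits W') : Prop := ∀ j, j ∉ Set.range f → x j = y j

omit [Fintype W] [DecidableEq W] [Fintype W'] [DecidableEq W'] in
theorem eq_iff_agreeOff (f : W ↪ W') (x y : Bits W') :
    x = y ↔ AgreeOff f x y ∧ x ∘ f = y ∘ f := by
  constructor
  · rintro rfl; exact ⟨fun _ _ => rfl, rfl⟩
  · rintro ⟨h1, h2⟩
    ext j
    by_cases hj : j ∈ Set.range f
    · obtain ⟨i, rfl⟩ := hj
      exact congrFun h2 i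
    · exact h1 j hj

omit [Fintype W] [Fintype W'] in
theorem eq_update_iff_agreeOff (f : W ↪ W') (x y : Bits W') (t : W) (b : Bool) :
    x = Function.update y (f t) b ↔
      AgreeOff f x y ∧ x ∘ f = Function.update (y ∘ f) t b := by
  rw [eq_iff_agreeOff f, ← Function.update_comp_eq_of_injective _ f.injective]
  apply and_congr_left
  intro _
  apply forall₂_congr
  intro j hj
  have : j ≠ f t := fun h => hj ⟨t, h.symm⟩
  simp [this]

open scoped Classical in
theorem Gate.toMatrix_map (f : W ↪ W') (g : Gate W) (x y : Bits W') :
    (g.map f).toMatrix x y = if AgreeOff f x y then g.toMatrix (x ∘ f) (y ∘ f) else 0 := by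
  cases g with
  | had i =>
    simp only [Gate.map, Gate.toMatrix, Matrix.of_apply, ← ite_and, Function.comp]
    congr 1
    apply propext
    constructor
    · intro h
      exact ⟨fun j hj => h j fun e => hj ⟨i, e.symm⟩, fun j hj => h (f j) (f.injective.ne hj)⟩
    · rintro ⟨h1, h2⟩ j hj
      by_cases h : j ∈ Set.range f
      · obtain ⟨k, rfl⟩ := h
        exact h2 k fun e => hj (by rw [e])
      · exact h1 j h
  | tee i =>
    simp only [Gate.map, Gate.toMatrix, Matrix.diagonal_apply, ← ite_and, Function.comp_apply,
      eq_iff_agreeOff f x y]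
  | cnot a t h =>
    simp only [Gate.map, Gate.toMatrix, Matrix.of_apply, ← ite_and, Function.comp_apply,
      eq_update_iff_agreeOff]
  | toffoli a b t h₁ h₂ h₃ =>
    simp only [Gate.map, Gate.toMatrix, Matrix.of_apply, ← ite_and, Function.comp_apply,
      eq_update_iff_agreeOff]

open scoped Classical in
/-- A circuit run on some of the wires acts as the identity on the others. -/
theorem circuitMatrix_map (f : W ↪ W') (L : List (Gate W)) (x y : Bits W') :
    circuitMatrix (L.map (Gate.map f)) x y =
      if AgreeOff f x y then circuitMatrix L (x ∘ f) (y ∘ f) else 0 := by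
  induction L generalizing y with
  | nil =>
    simp only [List.map_nil, circuitMatrix, Matrix.one_apply, ← ite_and, ← eq_iff_agreeOff]
  | cons g L ih =>
    simp only [List.map_cons, circuitMatrix, Matrix.mul_apply, ih, Gate.toMatrix_map]
    split_ifs with hxy
    · symm
      apply Fintype.sum_of_injective (fun v : Bits W => Function.extend f v y)
      · intro v v' h
        ext i
        simpa [f.injective.extend_apply] using congrFun h (f i)
      · intro z hz
        rw [if_neg (c := AgreeOff f z y), mul_zero]
        intro hzy
        apply hz
        refine ⟨z ∘ f, ?_⟩
        ext j
        by_cases hj : j ∈ Set.range f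
        · obtain ⟨i, rfl⟩ := hj
          simp [f.injective.extend_apply]
        · change Function.extend f (z ∘ f) y j = _
          rw [Function.extend_apply' _ _ _ (by simpa using hj), hzy j hj]
      · intro v
        have h1 : Function.extend f v y ∘ f = v := by
          ext i; simp [f.injective.extend_apply]
        have h2 : AgreeOff f (Function.extend f v y) y := fun j hj =>
          Function.extend_apply' _ _ _ (by simpa using hj)
        have h3 : AgreeOff f x (Function.extend f v y) := fun j hj => by
          rw [h2 j hj, hxy j hj]
        rw [if_pos h2, if_pos h3, h1]
    · apply Finset.sum_eq_zero
      intro z _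
      by_cases h1 : AgreeOff f x z
      · rw [if_neg (c := AgreeOff f z y), mul_zero]
        exact fun h2 => hxy fun j hj => (h1 j hj).trans (h2 j hj)
      · rw [if_neg h1, zero_mul]

omit [Fintype W] [DecidableEq W] [Fintype W'] [DecidableEq W'] in
theorem extend_comp_embedding (f : W ↪ W') (v : Bits W) (r : Bits W') :
    Function.extend f v r ∘ f = v := by
  ext i
  simp [f.injective.extend_apply]

omit [Fintype W] [DecidableEq W] [Fintype W'] [DecidableEq W'] in
theorem agreeOff_extend (f : W ↪ W') (v : Bits W) (r : Bits W') :
    AgreeOff f (Function.extend f v r) r := fun j hj =>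
  Function.extend_apply' _ _ _ (by simpa using hj)

omit [Fintype W] [DecidableEq W] [Fintype W'] [DecidableEq W'] in
theorem extend_injective (f : W ↪ W') (r : Bits W') :
    Function.Injective fun v : Bits W => Function.extend f v r := by
  intro v v' h
  rw [← extend_comp_embedding f v r, ← extend_comp_embedding f v' r]
  exact congrArg (· ∘ f) h

omit [Fintype W] [DecidableEq W] [Fintype W'] [DecidableEq W'] in
theorem eq_extend_iff (f : W ↪ W') (v : Bits W) (r x : Bits W') :
    x = Function.extend f v r ↔ AgreeOff f x r ∧ x ∘ f = v := by
  constructor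
  · rintro rfl
    exact ⟨agreeOff_extend f v r, extend_comp_embedding f v r⟩
  · rintro ⟨h1, h2⟩
    rw [eq_iff_agreeOff f, extend_comp_embedding]
    exact ⟨fun j hj => (h1 j hj).trans (agreeOff_extend f v r j hj).symm, h2⟩

/-- The isometry adjoining to the wires `W` the other wires of `W'`, in the basis state `r`. -/
abbrev adjoin (f : W ↪ W') (r : Bits W') : Matrix (Bits W') (Bits W) ℂ :=
  basisMap fun v => Function.extend f v r

/-- Adjoining wires in a fixed basis state `r` intertwines a circuit with its relabelling. -/
theorem circuitMatrix_map_mul_basisMap (f : W ↪ W') (L : List (Gate W)) (r : Bits W') :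
    circuitMatrix (L.map (Gate.map f)) * adjoin f r =
      adjoin f r * circuitMatrix L := by
  classical
  ext x v
  have h1 : (circuitMatrix (L.map (Gate.map f)) * adjoin f r) x v =
      circuitMatrix (L.map (Gate.map f)) x (Function.extend f v r) := by
    simp [basisMap, Matrix.mul_apply]
  rw [h1, circuitMatrix_map, extend_comp_embedding]
  by_cases hx : AgreeOff f x r
  · have h2 : x = Function.extend f (x ∘ f) r := (eq_extend_iff _ _ _ _).2 ⟨hx, rfl⟩
    rw [if_pos (c := AgreeOff f x _) fun j hj =>
      (hx j hj).trans (agreeOff_extend f v r j hj).symm]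
    conv_rhs => rw [h2]
    exact (basisMap_mul_apply _ (extend_injective f r) _ _ _).symm
  · rw [if_neg (c := AgreeOff f x _) fun h => hx fun j hj =>
        (h j hj).trans (agreeOff_extend f v r j hj),
      basisMap_mul_apply_of_notMem]
    rintro ⟨u, rfl⟩
    exact hx (agreeOff_extend f u r)

/-- Projecting the additional wires onto a fixed basis state `r` intertwines a circuit with its
relabelling. -/
theorem conjTranspose_basisMap_mul_circuitMatrix_map (f : W ↪ W') (L : List (Gate W))
    (r : Bits W') :
    (adjoin f r)ᴴ * circuitMatrix (L.map (Gate.map f)) =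
      circuitMatrix L * (adjoin f r)ᴴ := by
  classical
  ext v x
  have h1 : ((adjoin f r)ᴴ * circuitMatrix (L.map (Gate.map f))) v x =
      circuitMatrix (L.map (Gate.map f)) (Function.extend f v r) x := by
    simp [basisMap, Matrix.mul_apply, conjTranspose_apply, apply_ite star]
  rw [h1, circuitMatrix_map, extend_comp_embedding, Matrix.mul_apply]
  simp only [basisMap, conjTranspose_apply, Matrix.of_apply, eq_extend_iff, apply_ite star,
    star_one, star_zero, mul_ite, mul_one, mul_zero, ite_and]
  by_cases hx : AgreeOff f x r
  · rw [if_pos (c := AgreeOff f _ x) fun j hj =>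
      (agreeOff_extend f v r j hj).trans (hx j hj).symm]
    simp [hx]
  · rw [if_neg (c := AgreeOff f _ x) fun h => hx fun j hj =>
      (h j hj).symm.trans (agreeOff_extend f v r j hj)]
    simp [hx]

/-- Hadamard gates on a list of distinct wires. -/
theorem circuitMatrix_had (L : List W) (hL : L.Nodup) (x y : Bits W) :
    circuitMatrix (L.map Gate.had) x y =
      if ∀ j, j ∉ L → x j = y j then (L.map fun j => hadMatrix (x j) (y j)).prod else 0 := by
  induction L generalizing y with
  | nil =>
    simp only [List.map_nil, circuitMatrix, Matrix.one_apply, List.not_mem_nil,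
      not_false_eq_true, true_implies, List.prod_nil, funext_iff]
  | cons i L ih =>
    obtain ⟨hi, hL⟩ := List.nodup_cons.1 hL
    simp only [List.map_cons, circuitMatrix, Matrix.mul_apply, ih hL, List.prod_cons]
    rw [sum_eq_sum_update i y, Finset.sum_eq_single (x i)]
    · have h1 : ((∀ j, j ∉ L → x j = Function.update y i (x i) j)) ↔
          (∀ j, j ∉ i :: L → x j = y j) := by
        constructor
        · intro h j hj
          rw [List.mem_cons, not_or] at hj
          rw [h j hj.2, Function.update_of_ne hj.1]
        · intro h j hj
          by_cases hji : j = i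
          · subst hji; simp
          · rw [Function.update_of_ne hji, h j (by simp [hji, hj])]
      have h2 : (L.map fun j => hadMatrix (x j) (Function.update y i (x i) j)) =
          L.map fun j => hadMatrix (x j) (y j) := by
        apply List.map_congr_left
        intro j hj
        rw [Function.update_of_ne (by rintro rfl; exact hi hj)]
      have h3 : ∀ j, j ≠ i → Function.update y i (x i) j = y j := fun j hj => by simp [hj]
      rw [h2]
      simp only [h1, Gate.toMatrix, Matrix.of_apply, if_pos h3, Function.update_self]
      split_ifs
      · ring
      · ring
    · intro b _ hb
      rw [if_neg, zero_mul]
      intro h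
      have := h i hi
      simp only [Function.update_self] at this
      exact hb this.symm
    · simp
    · intro z hz
      simp only [Gate.toMatrix, Matrix.of_apply, if_neg hz, mul_zero]

end Circuits

/-! ### Reversible evaluation of Boolean formulas -/

/-- Boolean formulas in the variables `V`, over conjunction and exclusive or. -/
inductive BoolFormula (V : Type) : Type
  /-- A variable. -/
  | var (v : V) : BoolFormula V
  /-- The conjunction of two formulas. -/
  | and (φ ψ : BoolFormula V) : BoolFormula V
  /-- The exclusive or of two formulas. -/
  | xor (φ ψ : BoolFormula V) : BoolFormula V

namespace BoolFormula

variable {V : Type}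

/-- The truth value of a formula. -/
def eval (x : V → Bool) : BoolFormula V → Bool
  | var v => x v
  | and φ ψ => φ.eval x && ψ.eval x
  | xor φ ψ => Bool.xor (φ.eval x) (ψ.eval x)

/-- The number of nodes of a formula. -/
def size : BoolFormula V → ℕ
  | var _ => 1
  | and φ ψ => φ.size + ψ.size + 1
  | xor φ ψ => φ.size + ψ.size + 1

/-- Negation, given a variable `one` which is always true. -/
def neg (one : V) (φ : BoolFormula V) : BoolFormula V := xor φ (var one)

/-- The conjunction of a list of formulas, given a variable `one` which is always true. -/
def conj (one : V) (l : List (BoolFormula V)) : BoolFormula V := l.foldr and (var one)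

theorem eval_neg {one : V} {x : V → Bool} (h : x one = true) (φ : BoolFormula V) :
    (neg one φ).eval x = !φ.eval x := by
  simp [neg, eval, h]

theorem eval_conj {one : V} {x : V → Bool} (h : x one = true) (l : List (BoolFormula V)) :
    (conj one l).eval x = true ↔ ∀ φ ∈ l, φ.eval x = true := by
  induction l with
  | nil => simp [conj, eval, h]
  | cons φ l ih => simpa [conj, eval] using fun _ => ih

theorem size_neg (one : V) (φ : BoolFormula V) : (neg one φ).size = φ.size + 2 := rfl

theorem size_conj_le {one : V} {l : List (BoolFormula V)} {B : ℕ} (h : ∀ φ ∈ l, φ.size ≤ B) :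
    (conj one l).size ≤ l.length * (B + 1) + 1 := by
  induction l with
  | nil => simp [conj, size]
  | cons φ l ih =>
    have h1 := h φ (by simp)
    have h2 := ih fun ψ hψ => h ψ (by simp [hψ])
    simp only [conj, List.foldr_cons, size, List.length_cons] at h2 ⊢
    nlinarith

variable {W : Type} [Fintype W] [DecidableEq W]

/-- A formula can be evaluated by a reversible circuit of linear size with one fresh ancilla per
node. Each node writes its value to its own ancilla, so the two inputs of a Toffoli gate are
distinct wires even when a subformula or variable is repeated. -/
theorem exists_circuit (φ : BoolFormula V) (ι : V → W) (κ : Fin φ.size → W)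
    (hκ : Function.Injective κ) (hι : ∀ v k, ι v ≠ κ k) :
    ∃ (L : List (Gate W)) (F : Bits W → Bits W) (r : Fin φ.size),
      L.length ≤ 2 * φ.size ∧ circuitMatrix L = basisMap F ∧
      (∀ x w, w ∉ Set.range κ → F x w = x w) ∧
      ∀ x : Bits W, (∀ k, x (κ k) = false) → F x (κ r) = φ.eval (x ∘ ι) := by
  -- The inputs of the root node: both subformulas are evaluated, and nothing else has changed.
  have pair : ∀ (φ ψ : BoolFormula V) (κ : Fin (φ.size + ψ.size + 1) → W)
      (_ : Function.Injective κ) (_ : ∀ v k, ι v ≠ κ k)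
      (_ : ∀ κ : Fin φ.size → W, Function.Injective κ → (∀ v k, ι v ≠ κ k) →
        ∃ (L : List (Gate W)) (F : Bits W → Bits W) (r : Fin φ.size),
          L.length ≤ 2 * φ.size ∧ circuitMatrix L = basisMap F ∧
          (∀ x w, w ∉ Set.range κ → F x w = x w) ∧
          ∀ x : Bits W, (∀ k, x (κ k) = false) → F x (κ r) = φ.eval (x ∘ ι))
      (_ : ∀ κ : Fin ψ.size → W, Function.Injective κ → (∀ v k, ι v ≠ κ k) →
        ∃ (L : List (Gate W)) (F : Bits W → Bits W) (r : Fin ψ.size),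
          L.length ≤ 2 * ψ.size ∧ circuitMatrix L = basisMap F ∧
          (∀ x w, w ∉ Set.range κ → F x w = x w) ∧
          ∀ x : Bits W, (∀ k, x (κ k) = false) → F x (κ r) = ψ.eval (x ∘ ι)),
      ∃ (L : List (Gate W)) (F : Bits W → Bits W) (a b : Fin (φ.size + ψ.size + 1)),
        a ≠ b ∧ a ≠ Fin.last _ ∧ b ≠ Fin.last _ ∧
        L.length ≤ 2 * (φ.size + ψ.size) ∧ circuitMatrix L = basisMap F ∧
        (∀ x w, (∀ k, k ≠ Fin.last _ → κ k ≠ w) → F x w = x w) ∧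
        ∀ x : Bits W, (∀ k, x (κ k) = false) →
          F x (κ a) = φ.eval (x ∘ ι) ∧ F x (κ b) = ψ.eval (x ∘ ι) := by
    intro φ ψ κ hκ hι ih1 ih2
    obtain ⟨L₁, F₁, r₁, hl₁, hm₁, hf₁, he₁⟩ := ih1 (fun k => κ (Fin.castAdd 1 (Fin.castAdd _ k)))
      (fun k k' h => by simpa using hκ h) (fun v k => hι v _)
    obtain ⟨L₂, F₂, r₂, hl₂, hm₂, hf₂, he₂⟩ := ih2 (fun k => κ (Fin.castAdd 1 (Fin.natAdd _ k)))
      (fun k k' h => by simpa using hκ h) (fun v k => hι v _)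
    refine ⟨L₁ ++ L₂, F₂ ∘ F₁, Fin.castAdd 1 (Fin.castAdd _ r₁), Fin.castAdd 1 (Fin.natAdd _ r₂),
      ?_, ?_, ?_, ?_, ?_, ?_, ?_⟩
    · intro h
      have := congrArg Fin.val h
      simp at this
      omega
    · intro h
      have := congrArg Fin.val h
      simp at this
      omega
    · intro h
      have := congrArg Fin.val h
      simp at this
      omega
    · rw [List.length_append]; omega
    · rw [circuitMatrix_append, hm₁, hm₂, basisMap_mul]
    · intro x w hw
      rw [Function.comp_apply, hf₂, hf₁]
      · rintro ⟨k, rfl⟩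
        refine hw _ ?_ rfl
        intro h
        have := congrArg Fin.val h
        simp at this
        omega
      · rintro ⟨k, rfl⟩
        refine hw _ ?_ rfl
        intro h
        have := congrArg Fin.val h
        simp at this
        omega
    · intro x hx
      constructor
      · rw [Function.comp_apply, hf₂, he₁ x fun k => hx _]
        rintro ⟨k, h⟩
        have := congrArg Fin.val (hκ h)
        simp at this
        omega
      · rw [Function.comp_apply, he₂]
        · congr 1
          ext v
          apply hf₁
          rintro ⟨k, h⟩
          exact hι v _ h.symm
        · intro k
          rw [hf₁, hx]
          rintro ⟨k', h⟩
          have := congrArg Fin.val (hκ h)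
          simp at this
          omega
  induction φ with
  | var v =>
    have z : Fin (var v).size := (0 : Fin 1)
    refine ⟨[.cnot (ι v) (κ z) (hι v z)],
      fun y => Function.update y (κ z) (Bool.xor (y (κ z)) (y (ι v))), z, ?_, ?_, ?_, ?_⟩
    · simp [size]
    · rw [circuitMatrix, circuitMatrix, Matrix.one_mul]
      rfl
    · intro x w hw
      apply Function.update_of_ne
      rintro rfl
      exact hw ⟨_, rfl⟩
    · intro x hx
      have := hx z
      simp [this, eval]
  | and φ ψ ih1 ih2 =>
    obtain ⟨L, F, a, b, hab, ha, hb, hl, hm, hf, he⟩ := pair φ ψ κ hκ hι ih1 ih2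
    refine ⟨L ++ [.toffoli (κ a) (κ b) (κ (Fin.last _)) (hκ.ne hab) (hκ.ne ha) (hκ.ne hb)],
      (fun y => Function.update y (κ (Fin.last _))
        (Bool.xor (y (κ (Fin.last _))) (y (κ a) && y (κ b)))) ∘ F, Fin.last _, ?_, ?_, ?_, ?_⟩
    · simp only [List.length_append, List.length_singleton, size]
      omega
    · rw [circuitMatrix_append, hm, ← basisMap_mul, circuitMatrix, circuitMatrix, Matrix.one_mul]
      rfl
    · intro x w hw
      rw [Function.comp_apply, Function.update_of_ne, hf]
      · exact fun k _ h => hw ⟨k, h⟩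
      · rintro rfl
        exact hw ⟨_, rfl⟩
    · intro x hx
      obtain ⟨h1, h2⟩ := he x hx
      have h3 : F x (κ (Fin.last _)) = false := by
        refine (hf x _ ?_).trans (hx _)
        exact fun k hk h => hk (hκ h)
      simp [h1, h2, h3, eval]
  | xor φ ψ ih1 ih2 =>
    obtain ⟨L, F, a, b, hab, ha, hb, hl, hm, hf, he⟩ := pair φ ψ κ hκ hι ih1 ih2
    refine ⟨L ++ [.cnot (κ a) (κ (Fin.last _)) (hκ.ne ha), .cnot (κ b) (κ (Fin.last _)) (hκ.ne hb)],
      (fun y => Function.update y (κ (Fin.last _)) (Bool.xor (y (κ (Fin.last _))) (y (κ b)))) ∘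
      (fun y => Function.update y (κ (Fin.last _)) (Bool.xor (y (κ (Fin.last _))) (y (κ a)))) ∘ F,
      Fin.last _, ?_, ?_, ?_, ?_⟩
    · simp only [List.length_append, List.length_cons, List.length_nil, size]
      omega
    · rw [circuitMatrix_append, hm, ← basisMap_mul, ← basisMap_mul, circuitMatrix, circuitMatrix,
        circuitMatrix, Matrix.one_mul, Matrix.mul_assoc]
      rfl
    · intro x w hw
      have h : w ≠ κ (Fin.last _) := by
        rintro rfl
        exact hw ⟨_, rfl⟩
      rw [Function.comp_apply, Function.update_of_ne h, Function.comp_apply,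
        Function.update_of_ne h, hf]
      exact fun k _ h => hw ⟨k, h⟩
    · intro x hx
      obtain ⟨h1, h2⟩ := he x hx
      have h3 : F x (κ (Fin.last _)) = false := by
        refine (hf x _ ?_).trans (hx _)
        exact fun k hk h => hk (hκ h)
      have h4 : κ b ≠ κ (Fin.last _) := hκ.ne hb
      simp [h1, h2, h3, h4, eval]

end BoolFormula

/-! ### Polynomial bounds -/

theorem PolyBounded.mono {f g : ℕ → ℕ} (hg : PolyBounded g) (h : ∀ l, f l ≤ g l) :
    PolyBounded f := by
  obtain ⟨P, hP⟩ := hg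
  exact ⟨P, fun l => (h l).trans (hP l)⟩

theorem PolyBounded.add {f g : ℕ → ℕ} (hf : PolyBounded f) (hg : PolyBounded g) :
    PolyBounded fun l => f l + g l := by
  obtain ⟨P, hP⟩ := hf
  obtain ⟨Q, hQ⟩ := hg
  exact ⟨P + Q, fun l => by rw [Polynomial.eval_add]; exact add_le_add (hP l) (hQ l)⟩

theorem PolyBounded.mul {f g : ℕ → ℕ} (hf : PolyBounded f) (hg : PolyBounded g) :
    PolyBounded fun l => f l * g l := by
  obtain ⟨P, hP⟩ := hf
  obtain ⟨Q, hQ⟩ := hg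
  exact ⟨P * Q, fun l => by rw [Polynomial.eval_mul]; exact Nat.mul_le_mul (hP l) (hQ l)⟩

theorem PolyBounded.const (k : ℕ) : PolyBounded fun _ => k :=
  ⟨Polynomial.C k, fun _ => by simp⟩

/-! ### Building distinguishers -/

/-- The initial state of a circuit with input `ρ`, advice `α`, and ancillas in the state `0`. -/
def initialState {I A N : Type} [Fintype N] (ρ : QOp I) (α : QOp A) : QOp (I ⊕ (A ⊕ N)) :=
  Matrix.of fun x y =>
    ρ (fun i => x (.inl i)) (fun i => y (.inl i)) *
    α (fun i => x (.inr (.inl i))) (fun i => y (.inr (.inl i))) *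
    (if (∀ i, x (.inr (.inr i)) = false) ∧ (∀ i, y (.inr (.inr i)) = false) then 1 else 0)

theorem exists_equiv_unit_sum (W : Type) [Fintype W] [DecidableEq W] (w : W) :
    ∃ e : W ≃ Unit ⊕ Fin (Fintype.card W - 1), e w = .inl () := by
  have h : Fintype.card W = Fintype.card (Unit ⊕ Fin (Fintype.card W - 1)) := by
    have : 0 < Fintype.card W := Fintype.card_pos_iff.2 ⟨w⟩
    simp only [Fintype.card_sum, Fintype.card_unit, Fintype.card_fin]
    omega
  refine ⟨(Fintype.equivOfCardEq h).trans (Equiv.swap (Fintype.equivOfCardEq h w) (.inl ())), ?_⟩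
  simp

/-- The probability that wire `w` carries `1` in the state `τ`. -/
def wireProb {W : Type} [Fintype W] [DecidableEq W] (w : W) (τ : QOp W) : ℂ :=
  ∑ x, (if x w = true then 1 else 0) * τ x x

/-- Polynomial-size circuits over arbitrary finite types of advice and ancilla wires, read out on
one wire, are distinguishers. -/
theorem exists_distinguisher {In : ℕ → Type} [∀ l, Fintype (In l)] [∀ l, DecidableEq (In l)]
    (Adv Anc : ℕ → Type) [∀ l, Fintype (Adv l)] [∀ l, DecidableEq (Adv l)]
    [∀ l, Fintype (Anc l)] [∀ l, DecidableEq (Anc l)]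
    (α : ∀ l, QOp (Adv l)) (hα : ∀ l, IsDensity (α l))
    (C : ∀ l, List (Gate (In l ⊕ (Adv l ⊕ Anc l)))) (w : ∀ l, In l ⊕ (Adv l ⊕ Anc l))
    (hw : PolyBounded fun l => Fintype.card (In l) + Fintype.card (Adv l) + Fintype.card (Anc l))
    (hC : PolyBounded fun l => (C l).length) :
    ∃ D : Distinguisher In, ∀ l ρ, D.prOne l ρ =
      (wireProb (w l) (circuitMatrix (C l) * initialState ρ (α l) *
        (circuitMatrix (C l))ᴴ)).re := by
  let E : ∀ l, In l ⊕ (Adv l ⊕ Anc l) ≃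
      In l ⊕ (Fin (Fintype.card (Adv l)) ⊕ Fin (Fintype.card (Anc l))) := fun l =>
    Equiv.sumCongr (Equiv.refl _)
      (Equiv.sumCongr (Fintype.equivFin (Adv l)) (Fintype.equivFin (Anc l)))
  choose S hS using fun l => exists_equiv_unit_sum
    (In l ⊕ (Fin (Fintype.card (Adv l)) ⊕ Fin (Fintype.card (Anc l)))) (E l (w l))
  let D : Distinguisher In :=
    { adv := fun l => Fintype.card (Adv l)
      anc := fun l => Fintype.card (Anc l)
      disc := fun l => _
      advice := fun l => (α l).submatrix (fun x i => x (Fintype.equivFin (Adv l) i))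
        (fun x i => x (Fintype.equivFin (Adv l) i))
      advice_density := by
        intro l
        refine ⟨(hα l).1.submatrix _, ?_⟩
        rw [← (hα l).2]
        exact Equiv.sum_comp ((Fintype.equivFin (Adv l)).symm.arrowCongr (Equiv.refl Bool))
          (fun x => α l x x)
      circuit := fun l => (C l).map (Gate.map (E l).toEmbedding)
      split := S
      wires_poly := by simpa using hw
      size_poly := by simpa using hC }
  refine ⟨D, fun l ρ => ?_⟩
  -- relabelling the bit strings
  let b := (E l).symm.arrowCongr (Equiv.refl Bool)
  have hb : ∀ x, b x = x ∘ E l := fun x => rfl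
  have hU : circuitMatrix (D.circuit l) = (circuitMatrix (C l)).submatrix b b := by
    ext x y
    rw [circuitMatrix_map, if_pos]
    · rfl
    · intro j hj
      exact absurd ⟨(E l).symm j, by simp⟩ hj
  have hI : QPT.initial D l ρ = (initialState ρ (α l)).submatrix b b := by
    ext x y
    simp only [QPT.initial, initialState, Matrix.of_apply, Matrix.submatrix_apply, hb]
    congr 2
    have h : ∀ z : Bits (In l ⊕ (Fin (Fintype.card (Adv l)) ⊕ Fin (Fintype.card (Anc l)))),
        (∀ i, z (.inr (.inr i)) = false) ↔ ∀ i, (z ∘ E l) (.inr (.inr i)) = false := by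
      intro z
      constructor
      · intro h i
        exact h _
      · intro h i
        simpa [E] using h ((Fintype.equivFin (Anc l)).symm i)
    exact propext (and_congr (h x) (h y))
  unfold Distinguisher.prOne QPT.run
  simp only [Matrix.of_apply]
  rw [hU, hI, conjTranspose_submatrix, submatrix_mul_equiv, submatrix_mul_equiv]
  congr 1
  unfold wireProb
  rw [← Equiv.sum_comp b]
  apply Fintype.sum_of_injective (fun d v => Sum.elim (fun _ => true) d (S l v))
  · intro d d' h
    ext i
    simpa using congrFun h ((S l).symm (.inr i))
  · intro x hx
    rw [if_neg, zero_mul]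
    intro h
    apply hx
    refine ⟨fun i => x ((S l).symm (.inr i)), ?_⟩
    ext v
    obtain ⟨u, rfl⟩ := (S l).symm.surjective v
    rcases u with u | i
    · have : (S l).symm (.inl u) = E l (w l) := by rw [Equiv.symm_apply_eq, hS]
      beta_reduce
      rw [Equiv.apply_symm_apply, Sum.elim_inl, this]
      exact h.symm
    · simp
  · intro d
    rw [if_pos, one_mul]
    · rfl
    · change Sum.elim (fun _ => true) d (S l (E l (w l))) = true
      rw [hS]
      rfl

/-- Tracing out a register commutes with a circuit on the other wires. -/
theorem sum_diag_circuit_map {W R A : Type} [Fintype W] [DecidableEq W] [Fintype R] [DecidableEq R]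
    [Fintype A] [DecidableEq A] (S : W ≃ A ⊕ R) (f : A ↪ W) (hf : ∀ a, f a = S.symm (.inl a))
    (L : List (Gate A)) (τ : QOp W) (g : Bits A → ℂ) :
    ∑ v, g (v ∘ f) * (circuitMatrix (L.map (Gate.map f)) * τ *
        (circuitMatrix (L.map (Gate.map f)))ᴴ) v v =
      ∑ x, g x * (circuitMatrix L *
        (Matrix.of fun x y => ∑ d : Bits R, τ (fun w => Sum.elim x d (S w))
          (fun w => Sum.elim y d (S w))) * (circuitMatrix L)ᴴ) x x := by
  classical
  have hext : ∀ (d : Bits R) (x : Bits A), (fun w => Sum.elim x d (S w)) =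
      Function.extend f x (fun w => Sum.elim (fun _ => false) d (S w)) := by
    intro d x
    rw [eq_extend_iff]
    constructor
    · intro j hj
      obtain ⟨u, rfl⟩ := S.symm.surjective j
      rcases u with a | i
      · exact absurd ⟨a, hf a⟩ hj
      · simp
    · ext a
      simp [hf]
  let J : Bits R → Matrix (Bits W) (Bits A) ℂ := fun d =>
    adjoin f fun w => Sum.elim (fun _ => false) d (S w)
  have htr : (Matrix.of fun x y => ∑ d : Bits R, τ (fun w => Sum.elim x d (S w))
      (fun w => Sum.elim y d (S w))) = ∑ d, (J d)ᴴ * τ * J d := by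
    ext x y
    simp only [J, conjTranspose_basisMap_mul_mul, Matrix.sum_apply, Matrix.of_apply,
      Matrix.submatrix_apply]
    refine Finset.sum_congr rfl fun d _ => ?_
    rw [hext d x, hext d y]
  have hconj : circuitMatrix L * (∑ d, (J d)ᴴ * τ * J d) * (circuitMatrix L)ᴴ =
      ∑ d, (J d)ᴴ * (circuitMatrix (L.map (Gate.map f)) * τ *
        (circuitMatrix (L.map (Gate.map f)))ᴴ) * J d := by
    rw [Matrix.mul_sum, Matrix.sum_mul]
    refine Finset.sum_congr rfl fun d _ => ?_
    have h1 := conjTranspose_basisMap_mul_circuitMatrix_map f L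
      (fun w => Sum.elim (fun _ => false) d (S w))
    have h2 := congrArg conjTranspose h1
    rw [conjTranspose_mul, conjTranspose_mul, conjTranspose_conjTranspose] at h2
    calc circuitMatrix L * ((J d)ᴴ * τ * J d) * (circuitMatrix L)ᴴ
        = (circuitMatrix L * (J d)ᴴ) * τ * (J d * (circuitMatrix L)ᴴ) := by
          simp only [Matrix.mul_assoc]
      _ = ((J d)ᴴ * circuitMatrix (L.map (Gate.map f))) * τ *
            ((circuitMatrix (L.map (Gate.map f)))ᴴ * J d) := by rw [h1, h2]
      _ = _ := by simp only [Matrix.mul_assoc]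
  rw [htr, hconj]
  simp only [J, conjTranspose_basisMap_mul_mul, Matrix.sum_apply, Matrix.submatrix_apply,
    Finset.mul_sum, ← hext]
  rw [← Fintype.sum_prod_type']
  symm
  let e : Bits A × Bits R ≃ Bits W :=
    (Equiv.sumArrowEquivProdArrow A R Bool).symm.trans (S.symm.arrowCongr (Equiv.refl Bool))
  have he : ∀ p : Bits A × Bits R, e p = fun w => Sum.elim p.1 p.2 (S w) := fun p => rfl
  rw [← Equiv.sum_comp e]
  refine Finset.sum_congr rfl fun p _ => ?_
  rw [he]
  congr 2
  ext a
  simp [hf]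

/-! ### The Bell measurement -/

/-- The circuit which maps the Bell basis of each pair `(A_i, B_i)` to the computational basis:
afterwards `A_i` holds the phase error and `B_i` the bit error relative to
`(|00⟩ + |11⟩)/√2`. -/
def bellCircuit (n c : ℕ) : List (Gate (ABC n c)) :=
  (List.finRange n).map (fun i => Gate.cnot (.inl i) (.inr (.inl i)) (by simp)) ++
    ((List.finRange n).map Sum.inl).map Gate.had

theorem circuitMatrix_cnot_pairs {n c : ℕ} (l : List (Fin n)) (hl : l.Nodup) :
    circuitMatrix (l.map fun i => (Gate.cnot (.inl i) (.inr (.inl i)) (by simp) :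
      Gate (ABC n c))) =
      basisMap fun y => Sum.elim (fun i => y (.inl i)) (Sum.elim
        (fun i => if i ∈ l then Bool.xor (y (.inr (.inl i))) (y (.inl i)) else y (.inr (.inl i)))
        (fun k => y (.inr (.inr k)))) := by
  induction l with
  | nil =>
    ext x y
    simp only [List.map_nil, circuitMatrix, basisMap, Matrix.one_apply, Matrix.of_apply,
      List.not_mem_nil, if_false]
    congr 2
    ext j
    rcases j with j | j | j <;> rfl
  | cons i l ih =>
    obtain ⟨hi, hl⟩ := List.nodup_cons.1 hl
    rw [List.map_cons, circuitMatrix, ih hl]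
    change _ * basisMap _ = _
    rw [basisMap_mul]
    congr 1
    ext y j
    rcases j with j | j | j
    · simp
    · by_cases hj : j = i
      · subst hj
        simp [hi]
      · simp [hj]
    · simp

/-- The matrix entries of the Bell circuit. -/
theorem bellCircuit_apply (n c : ℕ) (x y : Bits (ABC n c)) :
    circuitMatrix (bellCircuit n c) x y =
      if (∀ i, x (.inr (.inl i)) = Bool.xor (y (.inr (.inl i))) (y (.inl i))) ∧
        (∀ k, x (.inr (.inr k)) = y (.inr (.inr k)))
      then ∏ i, hadMatrix (x (.inl i)) (y (.inl i)) else 0 := by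
  rw [bellCircuit, circuitMatrix_append, circuitMatrix_cnot_pairs _ (List.nodup_finRange n)]
  simp only [basisMap, Matrix.mul_apply, Matrix.of_apply, mul_ite, mul_one, mul_zero,
    Finset.sum_ite_eq', Finset.mem_univ, if_true]
  rw [circuitMatrix_had _ ((List.nodup_finRange n).map Sum.inl_injective)]
  congr 1
  · apply propext
    constructor
    · intro h
      refine ⟨fun i => ?_, fun k => ?_⟩
      · simpa using h (.inr (.inl i)) (by simp)
      · simpa using h (.inr (.inr k)) (by simp)
    · rintro ⟨h1, h2⟩ j hj
      rcases j with j | j | j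
      · exact absurd (by simp) hj
      · simpa using h1 j
      · simpa using h2 j
  · rw [List.map_map, ← List.ofFn_eq_map, List.prod_ofFn]
    rfl

/-! ### The block test -/

/-- The Bell outcome `(a, b)` (phase and bit errors) is compatible with equal outcomes in the
`θ`-basis: a bit error is visible where `θ i = 0`, and a phase error where `θ i = 1`. -/
def Consistent {n : ℕ} (θ a b : Bits (Fin n)) : Prop :=
  ∀ i, if θ i = true then a i = false else b i = false

instance {n : ℕ} (θ a b : Bits (Fin n)) : Decidable (Consistent θ a b) := by
  unfold Consistent
  infer_instance

/-- The first `⌊√n⌋²` positions are divided into `⌊√n⌋` blocks of `⌊√n⌋` positions; every block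
contains a phase error or a bit error. -/
def EveryBlockErr {n : ℕ} (a b : Bits (Fin n)) : Prop :=
  ∀ j : Fin (Nat.sqrt n), ∃ i : Fin n, (i : ℕ) / Nat.sqrt n = j ∧ (a i = true ∨ b i = true)

instance {n : ℕ} (a b : Bits (Fin n)) : Decidable (EveryBlockErr a b) := by
  unfold EveryBlockErr
  infer_instance

namespace BoolFormula

/-- The variables of the test: phase errors, bit errors, basis choices, and a constant `1`. -/
abbrev TestVar (n : ℕ) : Type := Fin n ⊕ (Fin n ⊕ (Fin n ⊕ Unit))

/-- The variable which is always true. -/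
abbrev one {n : ℕ} : TestVar n := .inr (.inr (.inr ()))

/-- Position `i` is consistent with the basis choice. -/
def consistentAt {n : ℕ} (i : Fin n) : BoolFormula (TestVar n) :=
  neg one (xor (xor (var (.inr (.inl i)))
    (and (var (.inr (.inr (.inl i)))) (var (.inr (.inl i)))))
    (and (var (.inr (.inr (.inl i)))) (var (.inl i))))

/-- Position `i` has neither a phase error nor a bit error. -/
def errorFree {n : ℕ} (i : Fin n) : BoolFormula (TestVar n) :=
  and (neg one (var (.inl i))) (neg one (var (.inr (.inl i))))

/-- Block `j` contains an error. -/
def blockErr {n : ℕ} (j : Fin (Nat.sqrt n)) : BoolFormula (TestVar n) :=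
  neg one (conj one (((List.finRange n).filter fun i : Fin n => (i : ℕ) / Nat.sqrt n = j).map errorFree))

/-- The block test as a formula. -/
def blockTest (n : ℕ) : BoolFormula (TestVar n) :=
  and (conj one ((List.finRange n).map consistentAt))
    (conj one ((List.finRange (Nat.sqrt n)).map blockErr))

theorem eval_blockTest {n : ℕ} (θ a b : Bits (Fin n)) :
    (blockTest n).eval (Sum.elim a (Sum.elim b (Sum.elim θ fun _ => true))) = true ↔
      Consistent θ a b ∧ EveryBlockErr a b := by
  set x : TestVar n → Bool := Sum.elim a (Sum.elim b (Sum.elim θ fun _ => true)) with hx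
  have h1 : x one = true := rfl
  have hc : ∀ i, (consistentAt i).eval x = true ↔
      (if θ i = true then a i = false else b i = false) := by
    intro i
    rw [consistentAt, eval_neg h1]
    simp only [eval, hx, Sum.elim_inl, Sum.elim_inr]
    cases θ i <;> cases a i <;> cases b i <;> simp
  have hf : ∀ i, (errorFree i).eval x = true ↔ ¬ (a i = true ∨ b i = true) := by
    intro i
    rw [errorFree, eval, eval_neg h1, eval_neg h1]
    simp only [eval, hx, Sum.elim_inl, Sum.elim_inr]
    cases a i <;> cases b i <;> simp
  have hb : ∀ j, (blockErr j).eval x = true ↔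
      ∃ i : Fin n, (i : ℕ) / Nat.sqrt n = j ∧ (a i = true ∨ b i = true) := by
    intro j
    rw [blockErr, eval_neg h1, Bool.not_eq_true', ← Bool.not_eq_true, eval_conj h1]
    simp only [List.mem_map, List.mem_filter, List.mem_finRange, true_and, decide_eq_true_eq,
      forall_exists_index, and_imp, forall_apply_eq_imp_iff₂, hf, not_forall, not_not, exists_prop]
  rw [blockTest, eval, Bool.and_eq_true, eval_conj h1, eval_conj h1]
  simp only [List.mem_map, List.mem_finRange, true_and, forall_exists_index,
    forall_apply_eq_imp_iff, hc, hb]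
  rfl

theorem size_blockTest_le (n : ℕ) : (blockTest n).size ≤ 8 * n ^ 2 + 20 * n + 3 := by
  have h1 : (conj one ((List.finRange n).map consistentAt)).size ≤ n * 12 + 1 := by
    have := size_conj_le (one := one) (l := (List.finRange n).map consistentAt) (B := 11) (by
      intro φ hφ
      obtain ⟨i, -, rfl⟩ := List.mem_map.1 hφ
      exact le_rfl)
    simpa using this
  have h2 : ∀ j : Fin (Nat.sqrt n), (blockErr j).size ≤ 8 * n + 3 := by
    intro j
    have := size_conj_le (one := one) (l := ((List.finRange n).filter
      fun i : Fin n => (i : ℕ) / Nat.sqrt n = j).map errorFree) (B := 7) (by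
      intro φ hφ
      obtain ⟨i, -, rfl⟩ := List.mem_map.1 hφ
      exact le_rfl)
    have hl := List.length_filter_le (fun i : Fin n => decide ((i : ℕ) / Nat.sqrt n = j))
      (List.finRange n)
    rw [List.length_finRange] at hl
    rw [List.length_map] at this
    rw [blockErr, size_neg]
    omega
  have h3 : (conj one ((List.finRange (Nat.sqrt n)).map blockErr)).size ≤
      n * (8 * n + 4) + 1 := by
    have := size_conj_le (one := one) (l := (List.finRange (Nat.sqrt n)).map blockErr)
      (B := 8 * n + 3) (by
      intro φ hφ
      obtain ⟨i, -, rfl⟩ := List.mem_map.1 hφ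
      exact h2 i)
    rw [List.length_map, List.length_finRange] at this
    exact this.trans (Nat.add_le_add_right (Nat.mul_le_mul_right _ (Nat.sqrt_le_self n)) 1)
  rw [blockTest, size]
  nlinarith

end BoolFormula

/-! ### The distinguisher which runs the block test -/

open scoped Classical in
theorem basisMap_extend_conj_apply {W W' : Type} [Fintype W] [DecidableEq W] [Fintype W']
    [DecidableEq W'] (f : W ↪ W') (r : Bits W') (M : QOp W) (x y : Bits W') :
    (adjoin f r * M *
      (adjoin f r)ᴴ) x y =
      if AgreeOff f x r ∧ AgreeOff f y r then M (x ∘ f) (y ∘ f) else 0 := by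
  have key : ∀ (N : Matrix (Bits W) (Bits W') ℂ) (u t : Bits W'),
      (adjoin f r * N) u t =
        if AgreeOff f u r then N (u ∘ f) t else 0 := by
    intro N u t
    split_ifs with h
    · have h2 : u = Function.extend f (u ∘ f) r := (eq_extend_iff _ _ _ _).2 ⟨h, rfl⟩
      conv_lhs => rw [h2]
      exact basisMap_mul_apply _ (extend_injective f r) N (u ∘ f) t
    · apply basisMap_mul_apply_of_notMem
      rintro ⟨v, rfl⟩
      exact h (agreeOff_extend f v r)
  have key2 : ∀ (u : Bits W) (t : Bits W'),
      (M * (adjoin f r)ᴴ) u t =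
        if AgreeOff f t r then M u (t ∘ f) else 0 := by
    intro u t
    simp only [Matrix.mul_apply, basisMap, conjTranspose_apply, Matrix.of_apply, eq_extend_iff,
      apply_ite star, star_one, star_zero, mul_ite, mul_one, mul_zero]
    split_ifs with h <;> simp [h]
  rw [Matrix.mul_assoc, key, key2, ite_and]

/-- An advice state together with one wire in the state `1`. -/
def withOne {A : Type} (α : QOp A) : QOp (A ⊕ Unit) :=
  Matrix.of fun x y => α (fun i => x (.inl i)) (fun i => y (.inl i)) *
    (if x (.inr ()) = true ∧ y (.inr ()) = true then 1 else 0)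

theorem withOne_isDensity {A : Type} [Fintype A] [DecidableEq A] {α : QOp A} (hα : IsDensity α) :
    IsDensity (withOne α) := by
  constructor
  · have h1 : (Matrix.vecMulVec (fun x : Bool => if x = true then (1 : ℂ) else 0)
        (star fun x : Bool => if x = true then (1 : ℂ) else 0)).PosSemidef :=
      posSemidef_vecMulVec_self_star _
    have h := (hα.1.kronecker h1).submatrix
      (fun x : Bits (A ⊕ Unit) => ((fun i => x (.inl i) : Bits A), x (.inr ())))
    have e : withOne α = (α ⊗ₖ Matrix.vecMulVec (fun x : Bool => if x = true then (1 : ℂ) else 0)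
        (star fun x : Bool => if x = true then (1 : ℂ) else 0)).submatrix
        (fun x : Bits (A ⊕ Unit) => ((fun i => x (.inl i) : Bits A), x (.inr ())))
        (fun x : Bits (A ⊕ Unit) => ((fun i => x (.inl i) : Bits A), x (.inr ()))) := by
      ext x y
      by_cases hx : x (.inr ()) = true <;> by_cases hy : y (.inr ()) = true <;>
        simp [withOne, vecMulVec_apply, hx, hy]
    rw [e]
    exact h
  · rw [← hα.2]
    symm
    apply Fintype.sum_of_injective (fun (x : Bits A) => (Sum.elim x fun _ => true : Bits (A ⊕ Unit)))
    · intro x y h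
      ext i
      exact congrFun h (.inl i)
    · intro x hx
      rw [diag_apply, withOne, Matrix.of_apply, if_neg, mul_zero]
      intro h
      apply hx
      refine ⟨fun i => x (.inl i), ?_⟩
      ext j
      rcases j with j | j
      · rfl
      · exact h.1.symm
    · intro x
      simp [withOne]

/-- The wires of the distinguisher: its input `(p, θ)`, the advice and ancillas of the preparation,
a constant `1`, and the ancillas which evaluate the block test. -/
abbrev TestWire (q n adv anc : ℕ) : Type :=
  (Fin q ⊕ Fin n) ⊕ ((Fin adv ⊕ Unit) ⊕ (Fin anc ⊕ Fin (BoolFormula.blockTest n).size))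

/-- The wires of the preparation among those of the distinguisher. -/
def prepWire (q n adv anc : ℕ) : Fin q ⊕ (Fin adv ⊕ Fin anc) ↪ TestWire q n adv anc where
  toFun := Sum.elim (fun i => .inl (.inl i))
    (Sum.elim (fun i => .inr (.inl (.inl i))) (fun i => .inr (.inr (.inl i))))
  inj' := by
    rintro (i | i | i) (j | j | j) h <;> simp at h ⊢ <;> exact h

theorem prepWire_inl (q n adv anc : ℕ) (i : Fin q) :
    prepWire q n adv anc (.inl i) = .inl (.inl i) := rfl

theorem prepWire_inr_inl (q n adv anc : ℕ) (i : Fin adv) :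
    prepWire q n adv anc (.inr (.inl i)) = .inr (.inl (.inl i)) := rfl

theorem prepWire_inr_inr (q n adv anc : ℕ) (i : Fin anc) :
    prepWire q n adv anc (.inr (.inr i)) = .inr (.inr (.inl i)) := rfl

/-- The state of the wires outside of the preparation. -/
def restState {q n adv anc : ℕ} (θ : Bits (Fin n)) : Bits (TestWire q n adv anc) :=
  Sum.elim (Sum.elim (fun _ => false) θ) (Sum.elim (Sum.elim (fun _ => false) fun _ => true)
    (fun _ => false))

theorem agreeOff_prepWire_iff {q n adv anc : ℕ} (θ : Bits (Fin n))
    (x : Bits (TestWire q n adv anc)) :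
    AgreeOff (prepWire q n adv anc) x (restState θ) ↔
      (∀ i, x (.inl (.inr i)) = θ i) ∧ x (.inr (.inl (.inr ()))) = true ∧
        ∀ k, x (.inr (.inr (.inr k))) = false := by
  constructor
  · intro h
    refine ⟨fun i => h (.inl (.inr i)) ?_, h (.inr (.inl (.inr ()))) ?_,
      fun k => h (.inr (.inr (.inr k))) ?_⟩
    all_goals
      rintro ⟨j | j | j, hj⟩ <;> simp [prepWire_inl, prepWire_inr_inl, prepWire_inr_inr] at hj
  · rintro ⟨h1, h2, h3⟩ j hj
    rcases j with (j | j) | (j | j) | j | j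
    · exact absurd ⟨.inl j, rfl⟩ hj
    · exact h1 j
    · exact absurd ⟨.inr (.inl j), rfl⟩ hj
    · exact h2
    · exact absurd ⟨.inr (.inr j), rfl⟩ hj
    · exact h3 j

open scoped Classical in
theorem initialState_single_apply {I A N : Type} [Fintype I] [Fintype N] (x₀ : Bits I)
    (α : QOp A) (x y : Bits (I ⊕ (A ⊕ N))) :
    initialState (Matrix.single x₀ x₀ 1) α x y =
      if ((∀ i, x (.inl i) = x₀ i) ∧ ∀ i, y (.inl i) = x₀ i) ∧
        (∀ i, x (.inr (.inr i)) = false) ∧ ∀ i, y (.inr (.inr i)) = false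
      then α (fun i => x (.inr (.inl i))) (fun i => y (.inr (.inl i))) else 0 := by
  have e : ∀ u : Bits I, x₀ = u ↔ ∀ i, u i = x₀ i := fun u =>
    eq_comm.trans funext_iff
  simp only [initialState, Matrix.of_apply, Matrix.single_apply, e]
  split_ifs <;> first | (simp; done) | tauto

theorem initialState_test {q n adv anc : ℕ} (α : QOp (Fin adv)) (p : Bits (Fin q))
    (θ : Bits (Fin n)) :
    (initialState (Matrix.single (Sum.elim p θ) (Sum.elim p θ) 1) (withOne α) :
      QOp (TestWire q n adv anc)) =
      adjoin (prepWire q n adv anc) (restState θ) *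
        (initialState (Matrix.single p p 1) α : QOp (Fin q ⊕ (Fin adv ⊕ Fin anc))) *
        (adjoin (prepWire q n adv anc) (restState θ))ᴴ := by
  classical
  ext x y
  rw [basisMap_extend_conj_apply, initialState_single_apply, initialState_single_apply]
  simp only [agreeOff_prepWire_iff, withOne, Matrix.of_apply, Function.comp_apply, prepWire_inl,
    prepWire_inr_inl, prepWire_inr_inr, Sum.forall, Sum.elim_inl, Sum.elim_inr]
  split_ifs <;> first | rfl | exact mul_one _ | exact mul_zero _ | tauto |
    (refine (mul_one _).trans (if_pos ?_).symm; tauto) | (refine (if_neg ?_).symm; tauto)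

/-- The circuit which runs a preparation, measures `A` and `B` in the Bell basis, and evaluates the
block test on the Bell outcomes and `θ`, and its success probability. -/
theorem exists_test_circuit {q n c adv anc disc : ℕ} (α : QOp (Fin adv))
    (L : List (Gate (Fin q ⊕ (Fin adv ⊕ Fin anc))))
    (S : Fin q ⊕ (Fin adv ⊕ Fin anc) ≃ ABC n c ⊕ Fin disc) :
    ∃ (C : List (Gate (TestWire q n adv anc))) (w : TestWire q n adv anc),
      C.length ≤ L.length + 2 * n + 2 * (BoolFormula.blockTest n).size ∧
      ∀ p θ, wireProb w (circuitMatrix C *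
          initialState (Matrix.single (Sum.elim p θ) (Sum.elim p θ) 1) (withOne α) *
          (circuitMatrix C)ᴴ) =
        ∑ x : Bits (ABC n c),
          (if Consistent θ (fun i => x (.inl i)) (fun i => x (.inr (.inl i))) ∧
            EveryBlockErr (fun i => x (.inl i)) (fun i => x (.inr (.inl i))) then 1 else 0) *
          (circuitMatrix (bellCircuit n c) *
            (Matrix.of fun x y => ∑ d : Bits (Fin disc),
              (circuitMatrix L * (initialState (Matrix.single p p 1) α :
                  QOp (Fin q ⊕ (Fin adv ⊕ Fin anc))) * (circuitMatrix L)ᴴ)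
                (fun w => Sum.elim x d (S w)) (fun w => Sum.elim y d (S w))) *
            (circuitMatrix (bellCircuit n c))ᴴ) x x := by
  classical
  let f := prepWire q n adv anc
  let h : ABC n c ↪ Fin q ⊕ (Fin adv ⊕ Fin anc) :=
    ⟨fun a => S.symm (.inl a), fun a b hab => by simpa using hab⟩
  let ι : BoolFormula.TestVar n → TestWire q n adv anc :=
    Sum.elim (fun i => f (h (.inl i))) (Sum.elim (fun i => f (h (.inr (.inl i))))
      (Sum.elim (fun i => .inl (.inr i)) fun _ => .inr (.inl (.inr ()))))
  let κ : Fin (BoolFormula.blockTest n).size → TestWire q n adv anc :=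
    fun k => .inr (.inr (.inr k))
  have hfκ : ∀ j k, f j ≠ κ k := by
    rintro (j | j | j) k hj
    · cases hj
    · cases hj
    · cases hj
  obtain ⟨T, F, r, hlen, hT, -, hF⟩ := (BoolFormula.blockTest n).exists_circuit ι κ
    (fun k k' hk => by simpa [κ] using hk) (by
      rintro (j | j | j | j) k hj
      · exact hfκ _ _ hj
      · exact hfκ _ _ hj
      · cases hj
      · cases hj)
  let M := L ++ (bellCircuit n c).map (Gate.map h)
  refine ⟨M.map (Gate.map f) ++ T, κ r, ?_, fun p θ => ?_⟩
  · simp only [M, bellCircuit, List.length_append, List.length_map, List.length_finRange]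
    omega
  · let J := adjoin f (restState θ)
    have hFinj : Function.Injective F := by
      intro x y hxy
      have := circuitMatrix_isometry T
      rw [hT] at this
      have h2 := congrFun (congrFun this x) y
      rw [conjTranspose_basisMap_mul_apply, if_pos hxy, Matrix.one_apply] at h2
      by_contra hne
      simp [hne] at h2
    let σ : QOp (Fin q ⊕ (Fin adv ⊕ Fin anc)) := initialState (Matrix.single p p 1) α
    let τ := circuitMatrix L * σ * (circuitMatrix L)ᴴ
    have hstate : circuitMatrix (M.map (Gate.map f) ++ T) *
        initialState (Matrix.single (Sum.elim p θ) (Sum.elim p θ) 1) (withOne α) *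
          (circuitMatrix (M.map (Gate.map f) ++ T))ᴴ =
        basisMap (F ∘ fun v => Function.extend f v (restState θ)) *
          (circuitMatrix M * σ * (circuitMatrix M)ᴴ) *
        (basisMap (F ∘ fun v => Function.extend f v (restState θ)))ᴴ := by
      have h1 : circuitMatrix (M.map (Gate.map f) ++ T) * J =
          basisMap (F ∘ fun v => Function.extend f v (restState θ)) * circuitMatrix M := by
        rw [circuitMatrix_append, Matrix.mul_assoc, circuitMatrix_map_mul_basisMap, hT,
          ← Matrix.mul_assoc, basisMap_mul]
      have h2 := congrArg conjTranspose h1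
      rw [conjTranspose_mul, conjTranspose_mul] at h2
      rw [initialState_test]
      calc _ = (circuitMatrix (M.map (Gate.map f) ++ T) * J) * σ *
            (Jᴴ * (circuitMatrix (M.map (Gate.map f) ++ T))ᴴ) := by
            simp only [Matrix.mul_assoc, J, σ, f]
        _ = _ := by
            rw [h1, h2]
            simp only [Matrix.mul_assoc]
    have hM : circuitMatrix M * σ * (circuitMatrix M)ᴴ =
        circuitMatrix ((bellCircuit n c).map (Gate.map h)) * τ *
          (circuitMatrix ((bellCircuit n c).map (Gate.map h)))ᴴ := by
      simp only [M, τ, circuitMatrix_append, conjTranspose_mul, Matrix.mul_assoc]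
    rw [wireProb, hstate, sum_basisMap_conj_diag _ (hFinj.comp (extend_injective f _)), hM]
    rw [← sum_diag_circuit_map S h (fun a => rfl) (bellCircuit n c) τ
      (fun x => if Consistent θ (fun i => x (.inl i)) (fun i => x (.inr (.inl i))) ∧
            EveryBlockErr (fun i => x (.inl i)) (fun i => x (.inr (.inl i))) then 1 else 0)]
    refine Finset.sum_congr rfl fun v _ => ?_
    congr 1
    have hagree := (agreeOff_prepWire_iff θ _).1 (agreeOff_extend f v (restState θ))
    have hx : (Function.extend f v (restState θ)) ∘ ι =
        Sum.elim (fun i => v (h (.inl i))) (Sum.elim (fun i => v (h (.inr (.inl i))))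
          (Sum.elim θ fun _ => true)) := by
      have hv := extend_comp_embedding f v (restState θ)
      ext j
      rcases j with j | j | j | j
      · exact congrFun hv (h (.inl j))
      · exact congrFun hv (h (.inr (.inl j)))
      · exact hagree.1 j
      · exact hagree.2.1
    rw [Function.comp_apply, hF _ hagree.2.2, hx]
    simp only [BoolFormula.eval_blockTest, Function.comp_apply]

/-- For every preparation there is an efficient distinguisher which accepts `(p, θ)` with the
probability that the Bell measurement of the prepared state passes the block test. -/
theorem exists_test_distinguisher {q n c : ℕ → ℕ} (hn : PolyBounded n)
    (prep : Preparation q n c) :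
    ∃ D : Distinguisher (fun l => Fin (q l) ⊕ Fin (n l)), ∀ l p θ,
      D.prOne l (Matrix.single (Sum.elim p θ) (Sum.elim p θ) 1) =
        (∑ x : Bits (ABC (n l) (c l)),
          (if Consistent θ (fun i => x (.inl i)) (fun i => x (.inr (.inl i))) ∧
            EveryBlockErr (fun i => x (.inl i)) (fun i => x (.inr (.inl i))) then 1 else 0) *
          (circuitMatrix (bellCircuit (n l) (c l)) * prep.state l p *
            (circuitMatrix (bellCircuit (n l) (c l)))ᴴ) x x).re := by
  choose C w hC hP using fun l => exists_test_circuit (prep.advice l) (prep.circuit l)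
    (prep.split l)
  have hsize : PolyBounded fun l => (BoolFormula.blockTest (n l)).size := by
    refine (((PolyBounded.const 8).mul (hn.mul hn)).add
      (((PolyBounded.const 20).mul hn).add (PolyBounded.const 3))).mono fun l => ?_
    have := BoolFormula.size_blockTest_le (n l)
    rw [pow_two] at this
    omega
  obtain ⟨D, hD⟩ := exists_distinguisher (In := fun l => Fin (q l) ⊕ Fin (n l))
    (fun l => Fin (prep.adv l) ⊕ Unit)
    (fun l => Fin (prep.anc l) ⊕ Fin (BoolFormula.blockTest (n l)).size)
    (fun l => withOne (prep.advice l)) (fun l => withOne_isDensity (prep.advice_density l)) C w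
    (by
      refine ((prep.wires_poly.add hn).add (hsize.add (PolyBounded.const 1))).mono fun l => ?_
      simp only [Fintype.card_sum, Fintype.card_fin, Fintype.card_unit]
      omega)
    (by
      refine ((prep.size_poly.add ((PolyBounded.const 2).mul hn)).add
        ((PolyBounded.const 2).mul hsize)).mono fun l => hC l)
  refine ⟨D, fun l p θ => ?_⟩
  have hI : ∀ ρ, QPT.initial prep l ρ = initialState ρ (prep.advice l) := by
    intro ρ
    ext x y
    simp only [QPT.initial, initialState, Matrix.of_apply]
    congr
  rw [hD, hP]
  simp only [Preparation.state, QPT.run, hI]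

/-! ### Bell amplitudes of equal outcomes -/

theorem sum_prod_pairs {R : Type*} [CommSemiring R] {n : ℕ} (f : Fin n → Bool → Bool → R) :
    ∑ x : Bits (Fin n) × Bits (Fin n), ∏ i, f i (x.1 i) (x.2 i) = ∏ i, ∑ a, ∑ b, f i a b := by
  have h := Fintype.prod_sum (fun (i : Fin n) (p : Bool × Bool) => f i p.1 p.2)
  simp only [Fintype.sum_prod_type] at h
  rw [h, ← Equiv.sum_comp (Equiv.arrowProdEquivProdArrow (Fin n) (fun _ => Bool) (fun _ => Bool))]
  rfl

/-- One position of a Bell outcome is consistent with the basis choice `t`. -/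
def ConsistentBit (t a b : Bool) : Prop := if t = true then a = false else b = false

instance (t a b : Bool) : Decidable (ConsistentBit t a b) := by
  unfold ConsistentBit
  infer_instance

/-- The amplitude of the Bell state with phase error `a` and bit error `b` in the product vector
`H^t|k⟩ ⊗ H^t|k⟩`. -/
def bellAmpBit (t k a b : Bool) : ℝ :=
  if ConsistentBit t a b then
    (1 / Real.sqrt 2) * (if k && (if t then b else a) then -1 else 1) else 0

/-- The amplitudes in the Bell basis of the outcome `k` on both `A` and `B` in the `θ`-basis. -/
def bellAmp {n : ℕ} (θ k : Bits (Fin n)) (x : Bits (Fin n) × Bits (Fin n)) : ℝ :=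
  ∏ i, bellAmpBit (θ i) (k i) (x.1 i) (x.2 i)

theorem inv_sqrt_two_mul_self : (Real.sqrt 2)⁻¹ * (Real.sqrt 2)⁻¹ = 1 / 2 := by
  rw [← mul_inv, Real.mul_self_sqrt (by norm_num)]
  norm_num

theorem sum_had_mul_basis_eq_bellAmpBit (t k a b : Bool) :
    ∑ s, hadMatrix a s * ((if t then hadMatrix else 1) s k *
      (if t then hadMatrix else 1) (Bool.xor b s) k) = (bellAmpBit t k a b : ℂ) := by
  have h : ((Real.sqrt 2 : ℝ) : ℂ)⁻¹ * ((Real.sqrt 2 : ℝ) : ℂ)⁻¹ = 1 / 2 := by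
    rw [← Complex.ofReal_inv, ← Complex.ofReal_mul, inv_sqrt_two_mul_self]
    norm_num
  have h3 : ((Real.sqrt 2 : ℝ) : ℂ)⁻¹ * (1 / 2) + ((Real.sqrt 2 : ℝ) : ℂ)⁻¹ * (1 / 2) =
      ((Real.sqrt 2 : ℝ) : ℂ)⁻¹ := by ring
  cases t <;> cases k <;> cases a <;> cases b <;>
    simp [hadMatrix, bellAmpBit, ConsistentBit, Matrix.one_apply, h] <;> linear_combination h3

theorem sum_bellAmpBit_mul (t a b a' b' : Bool) :
    ∑ k, bellAmpBit t k a b * bellAmpBit t k a' b' =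
      if ConsistentBit t a b ∧ a = a' ∧ b = b' then 1 else 0 := by
  cases t <;> cases a <;> cases b <;> cases a' <;> cases b' <;>
    simp [bellAmpBit, ConsistentBit, inv_sqrt_two_mul_self] <;> norm_num

theorem sum_bellAmpBit_sq (t k : Bool) : ∑ a, ∑ b, bellAmpBit t k a b ^ 2 = 1 := by
  cases t <;> cases k <;> simp [bellAmpBit, ConsistentBit]

theorem bellAmpBit_zero_sq (t k : Bool) : bellAmpBit t k false false ^ 2 = 1 / 2 := by
  cases t <;> cases k <;> simp [bellAmpBit, ConsistentBit]

theorem sum_bellAmp_mul {n : ℕ} (θ : Bits (Fin n)) (x x' : Bits (Fin n) × Bits (Fin n)) :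
    ∑ k, bellAmp θ k x * bellAmp θ k x' =
      if Consistent θ x.1 x.2 ∧ x = x' then 1 else 0 := by
  simp only [bellAmp, ← Finset.prod_mul_distrib]
  rw [← Fintype.prod_sum (fun i k => bellAmpBit (θ i) k (x.1 i) (x.2 i) *
    bellAmpBit (θ i) k (x'.1 i) (x'.2 i))]
  simp only [sum_bellAmpBit_mul]
  rw [Finset.prod_ite_zero]
  simp only [Finset.mem_univ, true_implies, Finset.prod_const_one]
  congr 1
  apply propext
  rw [Prod.ext_iff, funext_iff, funext_iff]
  simp only [forall_and]
  rfl

/-- Every block has `⌊√n⌋` positions. -/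
theorem sqrt_le_card_block {n : ℕ} (j : Fin (Nat.sqrt n)) :
    Nat.sqrt n ≤ (Finset.univ.filter fun i : Fin n => (i : ℕ) / Nat.sqrt n = j).card := by
  have hlt : ∀ r : Fin (Nat.sqrt n), Nat.sqrt n * j + r < n := by
    intro r
    have h1 := j.isLt
    have h2 := r.isLt
    have h3 := Nat.sqrt_le n
    nlinarith
  have hinj : Function.Injective fun r : Fin (Nat.sqrt n) => (⟨Nat.sqrt n * j + r, hlt r⟩ : Fin n) := by
    intro r r' h
    have := congrArg Fin.val h
    simp only [Nat.add_left_cancel_iff] at this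
    exact Fin.ext this
  calc Nat.sqrt n = (Finset.univ.image fun r : Fin (Nat.sqrt n) =>
        (⟨Nat.sqrt n * j + r, hlt r⟩ : Fin n)).card := by
        rw [Finset.card_image_of_injective _ hinj, Finset.card_univ, Fintype.card_fin]
    _ ≤ _ := by
        apply Finset.card_le_card
        intro i hi
        obtain ⟨r, -, rfl⟩ := Finset.mem_image.1 hi
        simp only [Finset.mem_filter, Finset.mem_univ, true_and]
        rw [Nat.mul_add_div (Nat.zero_lt_of_lt r.isLt), Nat.div_eq_of_lt r.isLt, add_zero]

/-- A vector of equal outcomes has little weight on the Bell states without an error in some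
block: each error-free position contributes a factor `1/2`. -/
theorem sum_bellAmp_sq_le {n : ℕ} (θ k : Bits (Fin n)) :
    ∑ x : Bits (Fin n) × Bits (Fin n),
      (if EveryBlockErr x.1 x.2 then 0 else bellAmp θ k x) ^ 2 ≤
      Nat.sqrt n * (1 / 2 : ℝ) ^ Nat.sqrt n := by
  -- the weight on the Bell states without an error in block `j`
  have hblock : ∀ j : Fin (Nat.sqrt n), ∑ x : Bits (Fin n) × Bits (Fin n),
      ∏ i : Fin n, (if (i : ℕ) / Nat.sqrt n = j ∧ (x.1 i = true ∨ x.2 i = true) then 0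
        else bellAmpBit (θ i) (k i) (x.1 i) (x.2 i) ^ 2) ≤ (1 / 2 : ℝ) ^ Nat.sqrt n := by
    intro j
    rw [sum_prod_pairs (fun i a b => if (i : ℕ) / Nat.sqrt n = j ∧ (a = true ∨ b = true) then 0
        else bellAmpBit (θ i) (k i) a b ^ 2)]
    have h : ∀ i : Fin n, ∑ a, ∑ b, (if (i : ℕ) / Nat.sqrt n = j ∧ (a = true ∨ b = true) then 0
        else bellAmpBit (θ i) (k i) a b ^ 2) =
        if (i : ℕ) / Nat.sqrt n = j then (1 / 2 : ℝ) else 1 := by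
      intro i
      split_ifs with hi
      · simpa [hi] using bellAmpBit_zero_sq (θ i) (k i)
      · simpa [hi] using sum_bellAmpBit_sq (θ i) (k i)
    simp only [h]
    rw [Finset.prod_ite, Finset.prod_const, Finset.prod_const_one, mul_one]
    exact pow_le_pow_of_le_one (by norm_num) (by norm_num) (sqrt_le_card_block j)
  calc _ ≤ ∑ x : Bits (Fin n) × Bits (Fin n), ∑ j : Fin (Nat.sqrt n),
        ∏ i : Fin n, (if (i : ℕ) / Nat.sqrt n = j ∧ (x.1 i = true ∨ x.2 i = true) then 0
        else bellAmpBit (θ i) (k i) (x.1 i) (x.2 i) ^ 2) := by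
        refine Finset.sum_le_sum fun x _ => ?_
        have hnn : ∀ j : Fin (Nat.sqrt n), 0 ≤ ∏ i : Fin n,
            (if (i : ℕ) / Nat.sqrt n = j ∧ (x.1 i = true ∨ x.2 i = true) then 0
            else bellAmpBit (θ i) (k i) (x.1 i) (x.2 i) ^ 2) := by
          intro j
          apply Finset.prod_nonneg
          intro i _
          split_ifs
          · exact le_rfl
          · positivity
        split_ifs with hx
        · simpa using Finset.sum_nonneg fun j _ => hnn j
        · simp only [EveryBlockErr, not_forall, not_exists] at hx
          obtain ⟨j, hj⟩ := hx
          refine le_trans (le_of_eq ?_) (Finset.single_le_sum (fun j _ => hnn j)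
            (Finset.mem_univ j))
          rw [bellAmp, ← Finset.prod_pow]
          refine Finset.prod_congr rfl fun i _ => ?_
          rw [if_neg (hj i)]
    _ ≤ ∑ j : Fin (Nat.sqrt n), (1 / 2 : ℝ) ^ Nat.sqrt n := by
        rw [Finset.sum_comm]
        exact Finset.sum_le_sum fun j _ => hblock j
    _ = _ := by simp

/-- For a fixed Bell outcome with an error in every block, at most a fraction `2^{-⌊√n⌋}` of all
basis choices is consistent: every error excludes one of the two bases at its position. -/
theorem sum_consistent_le {n : ℕ} (a b : Bits (Fin n)) :
    ∑ θ : Bits (Fin n), (if Consistent θ a b ∧ EveryBlockErr a b then (1 : ℝ) else 0) ≤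
      2 ^ n * (1 / 2 : ℝ) ^ Nat.sqrt n := by
  by_cases hE : EveryBlockErr a b
  · have h1 : ∀ θ : Bits (Fin n), (if Consistent θ a b ∧ EveryBlockErr a b then (1 : ℝ) else 0) =
        ∏ i, (if ConsistentBit (θ i) (a i) (b i) then (1 : ℝ) else 0) := by
      intro θ
      rw [Finset.prod_ite_zero]
      simp only [hE, and_true, Finset.mem_univ, true_implies, Finset.prod_const_one]
      rfl
    simp only [h1]
    rw [← Fintype.prod_sum (fun i t => if ConsistentBit t (a i) (b i) then (1 : ℝ) else 0)]
    have h2 : ∀ i, ∑ t, (if ConsistentBit t (a i) (b i) then (1 : ℝ) else 0) ≤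
        2 * (if a i = true ∨ b i = true then 1 / 2 else 1) := by
      intro i
      cases a i <;> cases b i <;> simp [ConsistentBit]
    choose e he herr using hE
    have hcard : Nat.sqrt n ≤ (Finset.univ.filter fun i => a i = true ∨ b i = true).card := by
      have hinj : Function.Injective e := by
        intro j j' h
        have := he j
        rw [h, he j'] at this
        exact Fin.ext this.symm
      calc Nat.sqrt n = (Finset.univ.image e).card := by
            rw [Finset.card_image_of_injective _ hinj, Finset.card_univ, Fintype.card_fin]
        _ ≤ _ := by
            apply Finset.card_le_card
            intro i hi
            obtain ⟨j, -, rfl⟩ := Finset.mem_image.1 hi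
            simpa using herr j
    calc _ ≤ ∏ i : Fin n, (2 * (if a i = true ∨ b i = true then 1 / 2 else 1) : ℝ) :=
          Finset.prod_le_prod (fun i _ => Finset.sum_nonneg fun t _ => by split_ifs <;> norm_num)
            fun i _ => h2 i
      _ = 2 ^ n * (1 / 2 : ℝ) ^ (Finset.univ.filter fun i => a i = true ∨ b i = true).card := by
          rw [Finset.prod_mul_distrib, Finset.prod_ite, Finset.prod_const, Finset.prod_const,
            Finset.prod_const_one, mul_one, Finset.card_univ, Fintype.card_fin]
      _ ≤ _ := by
          gcongr ?_ * ?_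
          exact pow_le_pow_of_le_one (by norm_num) (by norm_num) hcard
  · simp only [hE, and_false, if_false, Finset.sum_const_zero]
    positivity

/-! ### Density operators of circuits -/

theorem initialState_isDensity {I A N : Type} [Fintype I] [DecidableEq I] [Fintype A]
    [DecidableEq A] [Fintype N] [DecidableEq N] {ρ : QOp I} {α : QOp A} (hρ : IsDensity ρ)
    (hα : IsDensity α) : IsDensity (initialState ρ α : QOp (I ⊕ (A ⊕ N))) := by
  constructor
  · have h1 : (Matrix.vecMulVec (fun x : Bits N => if ∀ i, x i = false then (1 : ℂ) else 0)
        (star fun x : Bits N => if ∀ i, x i = false then (1 : ℂ) else 0)).PosSemidef :=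
      posSemidef_vecMulVec_self_star _
    let s : Bits (I ⊕ (A ⊕ N)) → (Bits I × Bits A) × Bits N := fun x =>
      ((fun i => x (.inl i), fun i => x (.inr (.inl i))), fun i => x (.inr (.inr i)))
    have h := ((hρ.1.kronecker hα.1).kronecker h1).submatrix s
    have e : (initialState ρ α : QOp (I ⊕ (A ⊕ N))) = ((ρ ⊗ₖ α) ⊗ₖ Matrix.vecMulVec
        (fun x : Bits N => if ∀ i, x i = false then (1 : ℂ) else 0)
        (star fun x : Bits N => if ∀ i, x i = false then (1 : ℂ) else 0)).submatrix s s := by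
      ext x y
      by_cases hx : ∀ i, x (.inr (.inr i)) = false <;>
        by_cases hy : ∀ i, y (.inr (.inr i)) = false <;>
        simp [initialState, vecMulVec_apply, hx, hy, s]
    rw [e]
    exact h
  · have h : (ρ ⊗ₖ α).trace = 1 := by rw [trace_kronecker, hρ.2, hα.2, one_mul]
    rw [← h]
    symm
    apply Fintype.sum_of_injective (fun (x : Bits I × Bits A) =>
      (Sum.elim x.1 (Sum.elim x.2 fun _ => false) : Bits (I ⊕ (A ⊕ N))))
    · intro x y h
      refine Prod.ext ?_ ?_
      · ext i
        exact congrFun h (.inl i)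
      · ext i
        exact congrFun h (.inr (.inl i))
    · intro x hx
      rw [diag_apply, initialState, Matrix.of_apply, if_neg, mul_zero]
      intro h
      apply hx
      refine ⟨(fun i => x (.inl i), fun i => x (.inr (.inl i))), ?_⟩
      ext j
      rcases j with j | j | j
      · rfl
      · rfl
      · exact (h.1 j).symm
    · intro x
      simp [initialState]

theorem circuit_conj_isDensity {W : Type} [Fintype W] [DecidableEq W] (L : List (Gate W))
    {ρ : QOp W} (hρ : IsDensity ρ) :
    IsDensity (circuitMatrix L * ρ * (circuitMatrix L)ᴴ) := by
  refine ⟨hρ.1.mul_mul_conjTranspose_same _, ?_⟩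
  rw [Matrix.trace_mul_cycle, circuitMatrix_isometry, Matrix.one_mul, hρ.2]

/-- Algorithms map density operators to density operators. -/
theorem QPT.run_isDensity {In Out : ℕ → Type} [∀ l, Fintype (In l)] [∀ l, DecidableEq (In l)]
    [∀ l, Fintype (Out l)] [∀ l, DecidableEq (Out l)] (A : QPT In Out) (l : ℕ) {ρ : QOp (In l)}
    (hρ : IsDensity ρ) : IsDensity (A.run l ρ) := by
  have hI : QPT.initial A l ρ = initialState ρ (A.advice l) := by
    ext x y
    simp only [QPT.initial, initialState, Matrix.of_apply]
    congr
  have h := circuit_conj_isDensity (A.circuit l)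
    (initialState_isDensity (N := Fin (A.anc l)) hρ (A.advice_density l))
  simp only [QPT.run, hI]
  set τ := circuitMatrix (A.circuit l) * initialState ρ (A.advice l) *
    (circuitMatrix (A.circuit l))ᴴ
  constructor
  · have e : (Matrix.of fun (x y : Bits (Out l)) => ∑ d : Bits (Fin (A.disc l)),
        τ (fun w => Sum.elim x d (A.split l w)) (fun w => Sum.elim y d (A.split l w))) =
        ∑ d : Bits (Fin (A.disc l)), τ.submatrix (fun x w => Sum.elim x d (A.split l w))
          (fun x w => Sum.elim x d (A.split l w)) := by
      ext x y
      simp [Matrix.sum_apply]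
    rw [e]
    exact posSemidef_sum _ fun d _ => h.1.submatrix _
  · rw [← h.2]
    simp only [Matrix.trace, diag_apply, Matrix.of_apply]
    rw [← Fintype.sum_prod_type']
    exact Equiv.sum_comp ((Equiv.sumArrowEquivProdArrow (Out l) (Fin (A.disc l)) Bool).symm.trans
      ((A.split l).symm.arrowCongr (Equiv.refl Bool))) (fun x => τ x x)

theorem single_isDensity {X : Type} [Fintype X] [DecidableEq X] (x : X) :
    IsDensity (Matrix.single x x (1 : ℂ)) := by
  refine ⟨?_, Matrix.trace_single_eq_same _ _⟩
  rw [← Matrix.diagonal_single]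
  apply Matrix.PosSemidef.diagonal
  intro y
  by_cases h : y = x
  · subst h; simp
  · simp [h]

/-! ### Measuring in the `θ`-basis, seen in the Bell basis -/

/-- The registers `A`, `B` on one side and `C` on the other. -/
def splitABC (n c : ℕ) : Bits (ABC n c) ≃ (Bits (Fin n) × Bits (Fin n)) × Bits (Fin c) where
  toFun x := ((fun i => x (.inl i), fun i => x (.inr (.inl i))), fun i => x (.inr (.inr i)))
  invFun p := Sum.elim p.1.1 (Sum.elim p.1.2 p.2)
  left_inv x := by
    ext j
    rcases j with j | j | j <;> rfl
  right_inv _ := rfl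

theorem splitABC_symm_inl {n c : ℕ} (p : (Bits (Fin n) × Bits (Fin n)) × Bits (Fin c))
    (i : Fin n) : (splitABC n c).symm p (.inl i) = p.1.1 i := rfl

theorem splitABC_symm_inr_inl {n c : ℕ} (p : (Bits (Fin n) × Bits (Fin n)) × Bits (Fin c))
    (i : Fin n) : (splitABC n c).symm p (.inr (.inl i)) = p.1.2 i := rfl

theorem splitABC_symm_inr_inr {n c : ℕ} (p : (Bits (Fin n) × Bits (Fin n)) × Bits (Fin c))
    (i : Fin c) : (splitABC n c).symm p (.inr (.inr i)) = p.2 i := rfl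

/-- An operator on `ABC` as an operator on the tensor product of `AB` and `C`. -/
def bipartite {n c : ℕ} (ρ : QOp (ABC n c)) :
    Matrix ((Bits (Fin n) × Bits (Fin n)) × Bits (Fin c))
      ((Bits (Fin n) × Bits (Fin n)) × Bits (Fin c)) ℂ :=
  ρ.submatrix (splitABC n c).symm (splitABC n c).symm

/-- The state `ρ`, with the registers `A` and `B` expressed in the Bell basis. -/
def inBellBasis {n c : ℕ} (ρ : QOp (ABC n c)) : QOp (ABC n c) :=
  circuitMatrix (bellCircuit n c) * ρ * (circuitMatrix (bellCircuit n c))ᴴ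

theorem bipartite_posSemidef {n c : ℕ} {ρ : QOp (ABC n c)} (hρ : ρ.PosSemidef) :
    (bipartite ρ).PosSemidef := hρ.submatrix _

theorem trace_bipartite {n c : ℕ} (ρ : QOp (ABC n c)) : (bipartite ρ).trace = ρ.trace :=
  Equiv.sum_comp (splitABC n c).symm fun x => ρ x x

theorem postState_eq_slice {n c : ℕ} (ρ : QOp (ABC n c)) (θ kA kB : Bits (Fin n)) :
    postState ρ θ kA kB =
      slice (bipartite ρ) fun x => basisKet θ kA x.1 * basisKet θ kB x.2 := by
  ext z z'
  simp only [postState, slice_apply, Matrix.of_apply, Fintype.sum_prod_type]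
  rfl

theorem bellCircuit_mul_ketOp {n c : ℕ} (θ k : Bits (Fin n)) :
    (circuitMatrix (bellCircuit n c)).submatrix (splitABC n c).symm (splitABC n c).symm *
      (ketOp (fun x : Bits (Fin n) × Bits (Fin n) => basisKet θ k x.1 * basisKet θ k x.2) :
        Matrix ((Bits (Fin n) × Bits (Fin n)) × Bits (Fin c)) (Bits (Fin c)) ℂ) =
      ketOp fun x => (bellAmp θ k x : ℂ) := by
  ext ⟨⟨a, b⟩, z⟩ z'
  simp only [Matrix.mul_apply, Matrix.submatrix_apply, bellCircuit_apply, ketOp, Matrix.of_apply,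
    Fintype.sum_prod_type, splitABC_symm_inl, splitABC_symm_inr_inl, splitABC_symm_inr_inr,
    mul_ite, mul_zero, Finset.sum_ite_eq', Finset.mem_univ, if_true]
  by_cases hz : z = z'
  · subst hz
    have hb : ∀ a' b' : Bits (Fin n), (∀ i, b i = Bool.xor (b' i) (a' i)) ↔
        b' = fun i => Bool.xor (b i) (a' i) := by
      intro a' b'
      rw [funext_iff]
      refine forall_congr' fun i => ?_
      cases b i <;> cases b' i <;> cases a' i <;> simp
    simp only [implies_true, and_true, hb, ite_mul, zero_mul, Finset.sum_ite_eq', Finset.mem_univ, if_true]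
    simp only [basisKet, bellAmp, ← Finset.prod_mul_distrib]
    rw [← Fintype.prod_sum (fun i s => hadMatrix (a i) s * ((if θ i then hadMatrix else 1) s (k i) *
      (if θ i then hadMatrix else 1) (Bool.xor (b i) s) (k i)))]
    simp only [sum_had_mul_basis_eq_bellAmpBit]
    push_cast
    rfl
  · rw [if_neg hz]
    refine Finset.sum_eq_zero fun a' _ => Finset.sum_eq_zero fun b' _ => ?_
    rw [if_neg, zero_mul]
    rintro ⟨-, h⟩
    exact hz (funext h)

/-- The state of `C` after equal outcomes `k`, computed from the Bell amplitudes. -/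
theorem postState_same_eq_slice {n c : ℕ} (ρ : QOp (ABC n c)) (θ k : Bits (Fin n)) :
    postState ρ θ k k = slice (bipartite (inBellBasis ρ)) fun x => (bellAmp θ k x : ℂ) := by
  have hV := circuitMatrix_isometry (bellCircuit n c)
  have hρ : ρ = (circuitMatrix (bellCircuit n c))ᴴ * inBellBasis ρ *
      circuitMatrix (bellCircuit n c) := by
    rw [inBellBasis]
    calc ρ = (1 : QOp (ABC n c)) * ρ * 1 := by rw [Matrix.one_mul, Matrix.mul_one]
      _ = _ := by
        rw [← hV]
        simp only [Matrix.mul_assoc]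
  have hb : bipartite ρ =
      ((circuitMatrix (bellCircuit n c)).submatrix (splitABC n c).symm (splitABC n c).symm)ᴴ *
        bipartite (inBellBasis ρ) *
      (circuitMatrix (bellCircuit n c)).submatrix (splitABC n c).symm (splitABC n c).symm := by
    conv_lhs => rw [hρ]
    simp only [bipartite]
    rw [conjTranspose_submatrix, submatrix_mul_equiv, submatrix_mul_equiv]
  rw [postState_eq_slice, slice, slice, ← bellCircuit_mul_ketOp, hb, conjTranspose_mul]
  simp only [Matrix.mul_assoc]

theorem sum_slice_of_orthonormal {X Z K : Type} [Fintype X] [DecidableEq X] [Fintype Z]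
    [DecidableEq Z] [Fintype K] (ρ : Matrix (X × Z) (X × Z) ℂ) (u : K → X → ℂ) (S : X → Prop)
    [DecidablePred S]
    (h : ∀ x x', ∑ k, star (u k x) * u k x' = if S x ∧ x = x' then 1 else 0) (z z' : Z) :
    (∑ k, slice ρ (u k)) z z' = ∑ x, if S x then ρ (x, z) (x, z') else 0 := by
  simp only [Matrix.sum_apply, slice_apply]
  rw [Finset.sum_comm]
  refine Finset.sum_congr rfl fun x _ => ?_
  rw [Finset.sum_comm]
  have : ∀ x', ∑ k, star (u k x) * ρ (x, z) (x', z') * u k x' =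
      if x = x' then (if S x then ρ (x, z) (x', z') else 0) else 0 := by
    intro x'
    calc _ = (∑ k, star (u k x) * u k x') * ρ (x, z) (x', z') := by
          rw [Finset.sum_mul]
          exact Finset.sum_congr rfl fun k _ => by ring
      _ = _ := by
          rw [h]
          by_cases h1 : S x <;> by_cases h2 : x = x' <;> simp [h1, h2]
  simp only [this, Finset.sum_ite_eq, Finset.mem_univ, if_true]

theorem sum_basisKet_mul {n : ℕ} (θ a a' : Bits (Fin n)) :
    ∑ k, star (basisKet θ k a) * basisKet θ k a' = if a = a' then 1 else 0 := by
  have h1 : ∀ (t s s' : Bool), ∑ k, star ((if t then hadMatrix else 1) s k) *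
      (if t then hadMatrix else 1) s' k = if s = s' then 1 else 0 := by
    intro t s s'
    have hs : ∀ x y : Bool, hadMatrix x y = hadMatrix y x := by
      intro x y
      simp [hadMatrix, and_comm]
    cases t
    · cases s <;> cases s' <;> simp [Matrix.one_apply]
    · simpa only [if_true, hs s, hs s'] using hadMatrix_isometry s s'
  simp only [basisKet, star_prod, ← Finset.prod_mul_distrib]
  rw [← Fintype.prod_sum (fun i k => star ((if θ i then hadMatrix else 1) (a i) k) *
      (if θ i then hadMatrix else 1) (a' i) k)]
  simp only [h1]
  rw [Finset.prod_ite_zero]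
  simp [funext_iff]

/-- The outcomes in the `θ`-basis are exhaustive. -/
theorem sum_postState {n c : ℕ} (ρ : QOp (ABC n c)) (θ : Bits (Fin n)) :
    ∑ kA, ∑ kB, postState ρ θ kA kB = traceOutFirst (bipartite ρ) := by
  rw [← Fintype.sum_prod_type']
  simp only [postState_eq_slice]
  ext z z'
  rw [sum_slice_of_orthonormal (bipartite ρ)
    (fun (k : Bits (Fin n) × Bits (Fin n)) (x : Bits (Fin n) × Bits (Fin n)) =>
      basisKet θ k.1 x.1 * basisKet θ k.2 x.2) (fun _ => True)]
  · simp [traceOutFirst]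
  · intro x x'
    rw [Fintype.sum_prod_type]
    calc _ = (∑ k, star (basisKet θ k x.1) * basisKet θ k x'.1) *
          ∑ k, star (basisKet θ k x.2) * basisKet θ k x'.2 := by
          rw [Finset.sum_mul_sum]
          refine Finset.sum_congr rfl fun _ _ => Finset.sum_congr rfl fun _ _ => ?_
          rw [star_mul']
          ring
      _ = _ := by
          rw [sum_basisKet_mul, sum_basisKet_mul]
          by_cases h1 : x.1 = x'.1 <;> by_cases h2 : x.2 = x'.2 <;> simp [h1, h2, Prod.ext_iff]

/-! ### The operator bound on the final state -/

/-- The probability that the Bell measurement of `A` and `B` passes the block test for `θ`. -/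
def testProb {n c : ℕ} (ρ : QOp (ABC n c)) (θ : Bits (Fin n)) : ℝ :=
  (∑ x : Bits (ABC n c),
    (if Consistent θ (fun i => x (.inl i)) (fun i => x (.inr (.inl i))) ∧
      EveryBlockErr (fun i => x (.inl i)) (fun i => x (.inr (.inl i))) then 1 else 0) *
    inBellBasis ρ x x).re

/-- The contribution to the state of `C` of equal outcomes and Bell states with an error in every
block. -/
def testPart {n c : ℕ} (ρ : QOp (ABC n c)) (θ : Bits (Fin n)) : QOp (Fin c) :=
  ∑ k, slice (bipartite (inBellBasis ρ))
    fun x => ((if EveryBlockErr x.1 x.2 then bellAmp θ k x else 0 : ℝ) : ℂ)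

theorem inBellBasis_isDensity {n c : ℕ} {ρ : QOp (ABC n c)} (hρ : IsDensity ρ) :
    IsDensity (inBellBasis ρ) := circuit_conj_isDensity _ hρ

theorem testPart_posSemidef {n c : ℕ} {ρ : QOp (ABC n c)} (hρ : IsDensity ρ) (θ : Bits (Fin n)) :
    (testPart ρ θ).PosSemidef :=
  posSemidef_sum _ fun _ _ =>
    slice_posSemidef (bipartite_posSemidef (inBellBasis_isDensity hρ).1) _

theorem trace_testPart {n c : ℕ} {ρ : QOp (ABC n c)} (hρ : IsDensity ρ) (θ : Bits (Fin n)) :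
    (testPart ρ θ).trace = (testProb ρ θ : ℂ) := by
  have h1 : (testPart ρ θ).trace = ∑ x : Bits (ABC n c),
      (if Consistent θ (fun i => x (.inl i)) (fun i => x (.inr (.inl i))) ∧
        EveryBlockErr (fun i => x (.inl i)) (fun i => x (.inr (.inl i))) then 1 else 0) *
      inBellBasis ρ x x := by
    rw [Matrix.trace, ← Equiv.sum_comp (splitABC n c).symm, Fintype.sum_prod_type, Finset.sum_comm]
    refine Finset.sum_congr rfl fun z _ => ?_
    rw [diag_apply, testPart, sum_slice_of_orthonormal _ _
      (fun x => Consistent θ x.1 x.2 ∧ EveryBlockErr x.1 x.2)]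
    · refine Finset.sum_congr rfl fun x _ => ?_
      have e : ∀ (p : Prop) [Decidable p] (y : ℂ),
          (if p then y else 0) = (if p then 1 else 0) * y := by
        intro p _ y
        split_ifs <;> simp
      exact e _ _
    · intro x x'
      have h := sum_bellAmp_mul θ x x'
      simp only [Complex.star_def, Complex.conj_ofReal, ← Complex.ofReal_mul,
        ← Complex.ofReal_sum]
      by_cases hx : EveryBlockErr x.1 x.2
      · by_cases hxx : x = x'
        · subst hxx
          simp only [hx, if_true, h, and_true]
          split_ifs <;> simp
        · simp only [hxx, and_false, if_false] at h ⊢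
          rw [Complex.ofReal_eq_zero]
          by_cases hx' : EveryBlockErr x'.1 x'.2
          · simpa only [hx, hx', if_true] using h
          · simp [hx']
      · simp [hx]
  have h2 := (testPart_posSemidef hρ θ).trace_nonneg
  rw [testProb, ← h1]
  exact Complex.ext (by simp) (by simpa using (Complex.nonneg_iff.1 h2).2.symm)

/-- The bound on the state of `C` for equal outcomes, uniform in the outcome. -/
def equalBound {n c : ℕ} (ρ : QOp (ABC n c)) (θ : Bits (Fin n)) (t : ℝ) : QOp (Fin c) :=
  ((1 + t ^ 2 : ℝ) : ℂ) • testPart ρ θ +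
    (((1 + (t ^ 2)⁻¹) * (Nat.sqrt n * (1 / 2 : ℝ) ^ Nat.sqrt n) : ℝ) : ℂ) •
      traceOutFirst (bipartite (inBellBasis ρ))

/-- The vector of equal outcomes is split into its parts with and without an error in every block.
The first part is controlled by the test, the second has small norm. -/
theorem postState_same_le {n c : ℕ} {ρ : QOp (ABC n c)} (hρ : IsDensity ρ) (θ k : Bits (Fin n))
    {t : ℝ} (ht : 0 < t) : (equalBound ρ θ t - postState ρ θ k k).PosSemidef := by
  have hb := bipartite_posSemidef (inBellBasis_isDensity hρ).1
  set σ := bipartite (inBellBasis ρ) with hσ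
  let u : Bits (Fin n) → Bits (Fin n) × Bits (Fin n) → ℂ :=
    fun k x => ((if EveryBlockErr x.1 x.2 then bellAmp θ k x else 0 : ℝ) : ℂ)
  let v : Bits (Fin n) × Bits (Fin n) → ℂ :=
    fun x => ((if EveryBlockErr x.1 x.2 then 0 else bellAmp θ k x : ℝ) : ℂ)
  have huv : (fun x => (bellAmp θ k x : ℂ)) = u k + v := by
    ext x
    by_cases hx : EveryBlockErr x.1 x.2 <;> simp [u, v, hx]
  have h1 := slice_add_le hb (u k) v ht
  have h2 : (testPart ρ θ - slice σ (u k)).PosSemidef := by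
    have : testPart ρ θ - slice σ (u k) = ∑ k' ∈ Finset.univ.erase k, slice σ (u k') := by
      rw [testPart, ← Finset.add_sum_erase _ _ (Finset.mem_univ k), add_sub_cancel_left]
    rw [this]
    exact posSemidef_sum _ fun _ _ => slice_posSemidef hb _
  have h3 := slice_le_traceOutFirst hb v
  have hv : ∑ x, star (v x) * v x =
      ((∑ x : Bits (Fin n) × Bits (Fin n),
        (if EveryBlockErr x.1 x.2 then 0 else bellAmp θ k x) ^ 2 : ℝ) : ℂ) := by
    rw [Complex.ofReal_sum]
    refine Finset.sum_congr rfl fun x _ => ?_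
    simp only [v, Complex.star_def, Complex.conj_ofReal, ← Complex.ofReal_mul, pow_two]
  rw [hv] at h3
  set w := ∑ x : Bits (Fin n) × Bits (Fin n),
        (if EveryBlockErr x.1 x.2 then 0 else bellAmp θ k x) ^ 2 with hw
  set δ := Nat.sqrt n * (1 / 2 : ℝ) ^ Nat.sqrt n with hδ
  have h4 : (((δ - w : ℝ) : ℂ) • traceOutFirst σ).PosSemidef := by
    refine (traceOutFirst_posSemidef hb).smul ?_
    rw [Complex.zero_le_real]
    exact sub_nonneg.2 (sum_bellAmp_sq_le θ k)
  have ha : (0 : ℂ) ≤ ((1 + t ^ 2 : ℝ) : ℂ) := by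
    rw [Complex.zero_le_real]; positivity
  have ha' : (0 : ℂ) ≤ ((1 + (t ^ 2)⁻¹ : ℝ) : ℂ) := by
    rw [Complex.zero_le_real]; positivity
  have h := (h1.add (h2.smul ha)).add ((h3.add h4).smul ha')
  convert h using 1
  rw [postState_same_eq_slice, huv, equalBound, ← hσ, ← hδ]
  push_cast
  module

/-- The bound on the state of `C` and a key, for a fixed basis choice. -/
def outcomeBound {n c : ℕ} (ρ : QOp (ABC n c)) (θ : Bits (Fin n)) (t : ℝ) : QOp (Fin c) :=
  equalBound ρ θ t + ((2 : ℂ) ^ n)⁻¹ • traceOutFirst (bipartite ρ)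

theorem sum_keyWeight {K : Type} [Fintype K] [DecidableEq K] (P : K → K → ℂ) (r : ℂ) (i : K) :
    ∑ a, ∑ b, (if a = b then (if a = i then 1 else 0) else r) * P a b =
      r * ∑ a, ∑ b, P a b - r * ∑ k, P k k + P i i := by
  have h : ∀ a b, (if a = b then (if a = i then 1 else 0) else r) * P a b =
      r * P a b - (if a = b then r * P a b else 0) +
        (if a = b then (if a = i then P a b else 0) else 0) := by
    intro a b
    split_ifs <;> simp
  simp only [h, Finset.sum_add_distrib, Finset.sum_sub_distrib, Finset.sum_ite_eq, Finset.mem_univ,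
    if_true, Finset.sum_ite_eq', Finset.mul_sum]

theorem keyState_apply {n : ℕ} (kA kB i j : Bits (Fin n)) :
    keyState kA kB i j = if i = j then
      (if kA = kB then (if kA = i then 1 else 0) else ((2 : ℂ) ^ n)⁻¹) else 0 := by
  rw [keyState]
  by_cases h : kA = kB
  · subst h
    by_cases hij : i = j
    · subst hij
      by_cases hi : kA = i <;> simp [hi]
    · simp only [if_true, hij, if_false, Matrix.single_apply]
      rw [if_neg]
      rintro ⟨rfl, rfl⟩
      exact hij rfl
  · by_cases hij : i = j <;> simp [h, hij]

/-- For a fixed basis choice, the state of the key and `C` is at most `I ⊗ outcomeBound`. -/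
theorem sum_keyState_postState_le {n c : ℕ} {ρ : QOp (ABC n c)} (hρ : IsDensity ρ)
    (θ : Bits (Fin n)) {t : ℝ} (ht : 0 < t) :
    ((1 : QOp (Fin n)) ⊗ₖ outcomeBound ρ θ t -
      ∑ kA, ∑ kB, keyState kA kB ⊗ₖ postState ρ θ kA kB).PosSemidef := by
  have h1 : (∑ k, (Matrix.single k k 1 : QOp (Fin n)) ⊗ₖ
      (equalBound ρ θ t - postState ρ θ k k)).PosSemidef :=
    posSemidef_sum _ fun k _ => (single_isDensity k).1.kronecker (postState_same_le hρ θ k ht)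
  have h2 : (((2 : ℂ) ^ n)⁻¹ • ((1 : QOp (Fin n)) ⊗ₖ ∑ k, postState ρ θ k k)).PosSemidef := by
    refine (Matrix.PosSemidef.one.kronecker (posSemidef_sum _ fun k _ => ?_)).smul ?_
    · rw [postState_eq_slice]
      exact slice_posSemidef (bipartite_posSemidef hρ.1) _
    · have : ((2 : ℂ) ^ n)⁻¹ = (((2 : ℝ) ^ n)⁻¹ : ℝ) := by push_cast; rfl
      rw [this, Complex.zero_le_real]
      positivity
  convert h1.add h2 using 1
  ext ⟨i, z⟩ ⟨j, z'⟩
  have hT : ∑ a, ∑ b, postState ρ θ a b z z' = traceOutFirst (bipartite ρ) z z' := by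
    rw [← sum_postState ρ θ]
    simp only [Matrix.sum_apply]
  simp only [Matrix.sub_apply, Matrix.add_apply, Matrix.sum_apply, Matrix.smul_apply,
    kroneckerMap_apply, keyState_apply, outcomeBound, smul_eq_mul, Matrix.one_apply]
  by_cases hij : i = j
  · subst hij
    simp only [if_true, one_mul, sum_keyWeight, hT]
    simp only [Matrix.single_apply, and_self, ite_mul, one_mul, zero_mul, Finset.sum_ite_eq',
      Finset.mem_univ, if_true]
    ring
  · have hs : ∀ k, (Matrix.single k k (1 : ℂ)) i j = 0 := by
      intro k
      rw [Matrix.single_apply, if_neg]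
      rintro ⟨rfl, rfl⟩
      exact hij rfl
    simp [hij, hs]

theorem outcomeBound_posSemidef {n c : ℕ} {ρ : QOp (ABC n c)} (hρ : IsDensity ρ)
    (θ : Bits (Fin n)) (t : ℝ) : (outcomeBound ρ θ t).PosSemidef := by
  have ha : (0 : ℂ) ≤ ((1 + t ^ 2 : ℝ) : ℂ) := by
    rw [Complex.zero_le_real]; positivity
  have hb : (0 : ℂ) ≤ (((1 + (t ^ 2)⁻¹) * (Nat.sqrt n * (1 / 2 : ℝ) ^ Nat.sqrt n) : ℝ) : ℂ) := by
    rw [Complex.zero_le_real]; positivity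
  have hc : (0 : ℂ) ≤ ((2 : ℂ) ^ n)⁻¹ := by
    have : ((2 : ℂ) ^ n)⁻¹ = (((2 : ℝ) ^ n)⁻¹ : ℝ) := by push_cast; rfl
    rw [this, Complex.zero_le_real]
    positivity
  exact (((testPart_posSemidef hρ θ).smul ha).add ((traceOutFirst_posSemidef
    (bipartite_posSemidef (inBellBasis_isDensity hρ).1)).smul hb)).add
    ((traceOutFirst_posSemidef (bipartite_posSemidef hρ.1)).smul hc)

theorem trace_outcomeBound {n c : ℕ} {ρ : QOp (ABC n c)} (hρ : IsDensity ρ)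
    (θ : Bits (Fin n)) (t : ℝ) : (outcomeBound ρ θ t).trace =
      (((1 + t ^ 2) * testProb ρ θ + (1 + (t ^ 2)⁻¹) * (Nat.sqrt n * (1 / 2 : ℝ) ^ Nat.sqrt n) +
        (2 ^ n)⁻¹ : ℝ) : ℂ) := by
  rw [outcomeBound, equalBound, trace_add, trace_add, trace_smul, trace_smul, trace_smul,
    trace_testPart hρ, trace_traceOutFirst, trace_traceOutFirst, trace_bipartite, trace_bipartite,
    hρ.2, (inBellBasis_isDensity hρ).2]
  push_cast
  simp only [smul_eq_mul, mul_one]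

theorem sum_toReal_eq_one {X : Type} [Fintype X] (μ : PMF X) : ∑ x, (μ x).toReal = 1 := by
  rw [← ENNReal.toReal_sum fun x _ => μ.apply_ne_top x, ← tsum_fintype (L := .unconditional _),
    μ.tsum_coe, ENNReal.toReal_one]

/-- The final state of key, `C` and `θ` is at most `I ⊗ ω`, for an operator `ω` whose trace is
essentially the probability of passing the block test. -/
theorem exists_stateKCT_le {q n c : ℕ} (μ : PMF (Bits (Fin q) × Bits (Fin n)))
    (ρ : Bits (Fin q) → QOp (ABC n c)) (hρ : ∀ p, IsDensity (ρ p)) {t : ℝ} (ht : 0 < t) :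
    ∃ ω : Matrix (Bits (Fin c) × Bits (Fin n)) (Bits (Fin c) × Bits (Fin n)) ℂ,
      ω.PosSemidef ∧
      ω.trace = (((1 + t ^ 2) * (∑ x, (μ x).toReal * testProb (ρ x.1) x.2) +
        (1 + (t ^ 2)⁻¹) * (Nat.sqrt n * (1 / 2 : ℝ) ^ Nat.sqrt n) + (2 ^ n)⁻¹ : ℝ) : ℂ) ∧
      ((1 : QOp (Fin n)) ⊗ₖ ω - stateKCT μ ρ).PosSemidef := by
  have hμ : ∀ x, (0 : ℂ) ≤ (((μ x).toReal : ℝ) : ℂ) := fun x => by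
    rw [Complex.zero_le_real]; exact ENNReal.toReal_nonneg
  refine ⟨∑ x, (((μ x).toReal : ℝ) : ℂ) •
    (outcomeBound (ρ x.1) x.2 t ⊗ₖ (Matrix.single x.2 x.2 1 : QOp (Fin n))), ?_, ?_, ?_⟩
  · exact posSemidef_sum _ fun x _ => ((outcomeBound_posSemidef (hρ _) _ t).kronecker
      (single_isDensity x.2).1).smul (hμ x)
  · simp only [trace_sum, trace_smul, trace_kronecker, (single_isDensity _).2, mul_one,
      trace_outcomeBound (hρ _), smul_eq_mul, ← Complex.ofReal_mul, ← Complex.ofReal_sum]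
    refine congrArg Complex.ofReal ?_
    have e : ∑ x, (μ x).toReal * ((1 + t ^ 2) * testProb (ρ x.1) x.2) =
        (1 + t ^ 2) * ∑ x, (μ x).toReal * testProb (ρ x.1) x.2 := by
      rw [Finset.mul_sum]
      exact Finset.sum_congr rfl fun x _ => by ring
    simp only [mul_add (_ : ℝ) (_ + _) _, mul_add (_ : ℝ) ((1 + t ^ 2) * _) _,
      Finset.sum_add_distrib, ← Finset.sum_mul, sum_toReal_eq_one, one_mul, e]
  · have h : (∑ x, (((μ x).toReal : ℝ) : ℂ) •
        ((((1 : QOp (Fin n)) ⊗ₖ outcomeBound (ρ x.1) x.2 t -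
          ∑ kA, ∑ kB, keyState kA kB ⊗ₖ postState (ρ x.1) x.2 kA kB) ⊗ₖ
            (Matrix.single x.2 x.2 1 : QOp (Fin n))).submatrix
          (Equiv.prodAssoc (Bits (Fin n)) (Bits (Fin c)) (Bits (Fin n))).symm
          (Equiv.prodAssoc (Bits (Fin n)) (Bits (Fin c)) (Bits (Fin n))).symm)).PosSemidef :=
      posSemidef_sum _ fun x _ => (((sum_keyState_postState_le (hρ _) _ ht).kronecker
        (single_isDensity x.2).1).submatrix _).smul (hμ x)
    convert h using 1
    ext ⟨i, z, s⟩ ⟨j, z', s'⟩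
    simp only [stateKCT, Matrix.sub_apply, Matrix.sum_apply, Matrix.smul_apply, kroneckerMap_apply,
      Matrix.submatrix_apply, Equiv.prodAssoc_symm_apply, smul_eq_mul, sub_mul, mul_sub,
      Finset.sum_sub_distrib, Finset.mul_sum, Finset.sum_mul]
    refine congrArg₂ (fun a b : ℂ => a - b) ?_ ?_
    · exact Finset.sum_congr rfl fun x _ => by ring
    · refine Finset.sum_congr rfl fun x _ => Finset.sum_congr rfl fun a _ =>
        Finset.sum_congr rfl fun b _ => by ring

/-! ### Test probabilities in the real and the ideal experiment -/

theorem QPT.run_sum {In Out : ℕ → Type} [∀ l, Fintype (In l)] [∀ l, DecidableEq (In l)]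
    (A : QPT In Out) (l : ℕ) {X : Type} [Fintype X] (a : X → ℂ) (ρ : X → QOp (In l)) :
    A.run l (∑ x, a x • ρ x) = ∑ x, a x • A.run l (ρ x) := by
  have hI : A.initial l (∑ x, a x • ρ x) = ∑ x, a x • A.initial l (ρ x) := by
    ext y y'
    simp only [QPT.initial, Matrix.of_apply, Matrix.sum_apply, Matrix.smul_apply, smul_eq_mul,
      Finset.sum_mul, mul_assoc]
  ext y y'
  simp only [QPT.run, hI, Matrix.sum_mul, Matrix.mul_smul, Matrix.smul_mul,
    Matrix.of_apply, Matrix.sum_apply, Matrix.smul_apply, smul_eq_mul, Finset.mul_sum]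
  exact Finset.sum_comm

theorem pairState_eq_sum {q n : ℕ} (μ : PMF (Bits (Fin q) × Bits (Fin n))) :
    pairState μ = ∑ x, (((μ x).toReal : ℝ) : ℂ) •
      (Matrix.single (Sum.elim x.1 x.2) (Sum.elim x.1 x.2) 1 : QOp (Fin q ⊕ Fin n)) := by
  let e := Equiv.sumArrowEquivProdArrow (Fin q) (Fin n) Bool
  have hinv : ∀ (y : Bits (Fin q ⊕ Fin n)) (x : Bits (Fin q) × Bits (Fin n)),
      y = Sum.elim x.1 x.2 ↔ x = e y := by
    intro y x
    rw [← Equiv.symm_apply_eq, eq_comm]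
    rfl
  ext y y'
  rw [pairState, classicalState, Matrix.sum_apply]
  simp only [Matrix.smul_apply, Matrix.single_apply, smul_eq_mul]
  by_cases hyy : y = y'
  · subst hyy
    rw [Matrix.diagonal_apply_eq, PMF.map_apply, tsum_fintype]
    simp only [hinv, eq_comm (b := y), and_self, mul_ite, mul_one, mul_zero, Finset.sum_ite_eq',
      Finset.mem_univ, if_true]
  · rw [Matrix.diagonal_apply_ne _ hyy]
    symm
    refine Finset.sum_eq_zero fun x _ => ?_
    rw [if_neg, mul_zero]
    rintro ⟨rfl, rfl⟩
    exact hyy rfl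

theorem Distinguisher.prOne_pairState {q n : ℕ → ℕ}
    (D : Distinguisher fun l => Fin (q l) ⊕ Fin (n l)) (l : ℕ)
    (μ : PMF (Bits (Fin (q l)) × Bits (Fin (n l)))) :
    D.prOne l (pairState μ) = ∑ x, (μ x).toReal *
      D.prOne l (Matrix.single (Sum.elim x.1 x.2) (Sum.elim x.1 x.2) 1) := by
  unfold Distinguisher.prOne
  rw [pairState_eq_sum, QPT.run_sum]
  simp only [Matrix.sum_apply, Matrix.smul_apply, smul_eq_mul, Complex.re_sum,
    Complex.re_ofReal_mul]

theorem sum_bind_toReal {X Y : Type} [Fintype X] [Fintype Y] (μ : PMF X) (ν : X → PMF Y)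
    (G : Y → ℝ) : ∑ y, ((μ.bind ν) y).toReal * G y =
      ∑ x, (μ x).toReal * ∑ y, (ν x y).toReal * G y := by
  have h : ∀ y, ((μ.bind ν) y).toReal = ∑ x, (μ x).toReal * (ν x y).toReal := by
    intro y
    rw [PMF.bind_apply, tsum_fintype, ENNReal.toReal_sum]
    · simp only [ENNReal.toReal_mul]
    · intro x _
      exact ENNReal.mul_ne_top (μ.apply_ne_top x) ((ν x).apply_ne_top y)
  simp only [h, Finset.sum_mul, Finset.mul_sum, mul_assoc]
  exact Finset.sum_comm

theorem sum_map_toReal {X Y : Type} [Fintype X] [Fintype Y] (μ : PMF X) (f : X → Y) (G : Y → ℝ) :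
    ∑ y, ((μ.map f) y).toReal * G y = ∑ x, (μ x).toReal * G (f x) := by
  classical
  rw [PMF.map, sum_bind_toReal]
  refine Finset.sum_congr rfl fun x _ => congrArg _ ?_
  rw [Finset.sum_eq_single (f x)]
  · simp
  · intro y _ hy
    simp [hy]
  · simp

theorem sum_idealize {q n : ℕ} (μ : PMF (Bits (Fin q) × Bits (Fin n)))
    (G : Bits (Fin q) × Bits (Fin n) → ℝ) :
    ∑ y, (idealize μ y).toReal * G y =
      ∑ x, (μ x).toReal * ((2 ^ n)⁻¹ * ∑ θ, G (x.1, θ)) := by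
  rw [idealize, sum_bind_toReal]
  refine Finset.sum_congr rfl fun x _ => congrArg (fun r : ℝ => (μ x).toReal * r) ?_
  rw [sum_map_toReal, Finset.mul_sum]
  refine Finset.sum_congr rfl fun θ _ => ?_
  rw [PMF.uniformOfFintype_apply]
  simp

/-- For a uniform basis choice the block test is passed with probability at most `2^{-⌊√n⌋}`. -/
theorem sum_testProb_le {n c : ℕ} {ρ : QOp (ABC n c)} (hρ : IsDensity ρ) :
    ∑ θ, testProb ρ θ ≤ 2 ^ n * (1 / 2 : ℝ) ^ Nat.sqrt n := by
  have hd := inBellBasis_isDensity hρ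
  have h1 : ∀ θ, testProb ρ θ = ∑ x : Bits (ABC n c),
      (if Consistent θ (fun i => x (.inl i)) (fun i => x (.inr (.inl i))) ∧
        EveryBlockErr (fun i => x (.inl i)) (fun i => x (.inr (.inl i))) then (1 : ℝ) else 0) *
      (inBellBasis ρ x x).re := by
    intro θ
    rw [testProb, Complex.re_sum]
    refine Finset.sum_congr rfl fun x _ => ?_
    split_ifs <;> simp
  have htr : ∑ x, (inBellBasis ρ x x).re = 1 := by
    rw [← Complex.re_sum]
    exact (congrArg Complex.re hd.2).trans Complex.one_re
  simp only [h1]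
  rw [Finset.sum_comm]
  calc _ ≤ ∑ x : Bits (ABC n c), 2 ^ n * (1 / 2 : ℝ) ^ Nat.sqrt n * (inBellBasis ρ x x).re := by
        refine Finset.sum_le_sum fun x _ => ?_
        rw [← Finset.sum_mul]
        exact mul_le_mul_of_nonneg_right (sum_consistent_le _ _)
          (Complex.nonneg_iff.1 hd.1.diag_nonneg).1
    _ = _ := by rw [← Finset.mul_sum, htr, mul_one]

/-- The probability that the prepared state passes the block test in the game exceeds its value for
a uniform basis choice by at most the distinguishing advantage. -/
theorem eventually_testProb_le {q n : ℕ → ℕ}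
    {Z : ∀ l, PMF (Bits (Fin (q l)) × Bits (Fin (n l)))} {η : ℕ → ℝ} (hn : PolyBounded n)
    (hZ : StronglyHidden Z η) {c : ℕ → ℕ} (prep : Preparation q n c) :
    ∃ l₀ : ℕ, ∀ l ≥ l₀, ∑ x, (Z l x).toReal * testProb (prep.state l x.1) x.2 ≤
      (1 / 2 : ℝ) ^ Nat.sqrt (n l) + η l := by
  obtain ⟨D, hD⟩ := exists_test_distinguisher hn prep
  obtain ⟨l₀, hl₀⟩ := hZ.2 D
  refine ⟨l₀, fun l hl => ?_⟩
  have hD' : ∀ p θ, D.prOne l (Matrix.single (Sum.elim p θ) (Sum.elim p θ) 1) =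
      testProb (prep.state l p) θ := fun p θ => hD l p θ
  have h := (abs_le.1 (hl₀ l hl)).2
  rw [Distinguisher.prOne_pairState, Distinguisher.prOne_pairState] at h
  simp only [hD'] at h
  rw [sum_idealize (Z l) (fun x => testProb (prep.state l x.1) x.2)] at h
  have hideal : ∑ x, (Z l x).toReal * ((2 ^ n l)⁻¹ * ∑ θ, testProb (prep.state l x.1) θ) ≤
      (1 / 2 : ℝ) ^ Nat.sqrt (n l) := by
    calc _ ≤ ∑ x, (Z l x).toReal * (1 / 2 : ℝ) ^ Nat.sqrt (n l) := by
          refine Finset.sum_le_sum fun x _ =>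
            mul_le_mul_of_nonneg_left ?_ ENNReal.toReal_nonneg
          rw [inv_mul_le_iff₀ (by positivity)]
          exact sum_testProb_le (QPT.run_isDensity prep l (single_isDensity x.1))
      _ = _ := by rw [← Finset.sum_mul, sum_toReal_eq_one, one_mul]
  linarith

theorem testProb_nonneg {n c : ℕ} {ρ : QOp (ABC n c)} (hρ : IsDensity ρ) (θ : Bits (Fin n)) :
    0 ≤ testProb ρ θ := by
  have h := (testPart_posSemidef hρ θ).trace_nonneg
  rwa [trace_testPart hρ, Complex.zero_le_real] at h

/-! ### Conditional min-entropy -/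

/-- An operator bound `ρ ≤ I ⊗ ω` bounds the min-entropy by the trace of `ω`. -/
theorem le_condMinEntropy {A B : Type} [Fintype A] [DecidableEq A] [Fintype B] [DecidableEq B]
    {ρ : Matrix (A × B) (A × B) ℂ} {ω : Matrix B B ℂ} (hω : ω.PosSemidef) {T b : ℝ}
    (hT : ω.trace = (T : ℂ)) (hT0 : 0 < T) (hTb : T ≤ b)
    (h : ((1 : Matrix A A ℂ) ⊗ₖ ω - ρ).PosSemidef) :
    ((-Real.logb 2 b : ℝ) : EReal) ≤ condMinEntropy ρ := by
  have hb : 0 < b := hT0.trans_le hTb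
  rw [condMinEntropy, EReal.coe_neg, EReal.neg_le_neg_iff]
  have hσ : IsDensity (((T⁻¹ : ℝ) : ℂ) • ω) := by
    refine ⟨hω.smul ?_, ?_⟩
    · rw [Complex.zero_le_real]; positivity
    · rw [trace_smul, hT, smul_eq_mul, ← Complex.ofReal_mul, inv_mul_cancel₀ hT0.ne',
        Complex.ofReal_one]
  refine iInf₂_le_of_le (((T⁻¹ : ℝ) : ℂ) • ω) hσ (iInf₂_le (Real.logb 2 b) ?_)
  rw [Real.rpow_logb (by norm_num) (by norm_num) hb]
  have h2 : (((b / T - 1 : ℝ) : ℂ) • ((1 : Matrix A A ℂ) ⊗ₖ ω)).PosSemidef := by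
    refine (Matrix.PosSemidef.one.kronecker hω).smul ?_
    rw [Complex.zero_le_real, sub_nonneg, one_le_div hT0]
    exact hTb
  convert h.add h2 using 1
  rw [kronecker_smul, smul_smul, ← Complex.ofReal_mul, ← div_eq_mul_inv]
  push_cast
  module

/-- Discarding part of the side information does not decrease the min-entropy. -/
theorem condMinEntropy_le_traceOutLast {A B T : Type} [Fintype A] [DecidableEq A] [Fintype B]
    [Fintype T] (ρ : Matrix (A × (B × T)) (A × (B × T)) ℂ) :
    condMinEntropy ρ ≤ condMinEntropy (traceOutLast ρ) := by
  rw [condMinEntropy, condMinEntropy, EReal.neg_le_neg_iff]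
  refine le_iInf₂ fun σ hσ => le_iInf₂ fun r hr => ?_
  let σB : Matrix B B ℂ := Matrix.of fun z z' => ∑ t, σ (z, t) (z', t)
  have hσB : IsDensity σB := by
    constructor
    · have : σB = ∑ t, σ.submatrix (fun z => (z, t)) (fun z => (z, t)) := by
        ext z z'
        simp [σB, Matrix.sum_apply]
      rw [this]
      exact posSemidef_sum _ fun t _ => hσ.1.submatrix _
    · rw [← hσ.2]
      simp only [Matrix.trace, diag_apply, σB, Matrix.of_apply, Fintype.sum_prod_type]
  refine iInf₂_le_of_le σB hσB (iInf₂_le r ?_)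
  have h : (∑ t, ((((2 : ℝ) ^ r : ℝ) : ℂ) • ((1 : Matrix A A ℂ) ⊗ₖ σ) - ρ).submatrix
      (fun x : A × B => (x.1, (x.2, t))) (fun x : A × B => (x.1, (x.2, t)))).PosSemidef :=
    posSemidef_sum _ fun t _ => hr.submatrix _
  convert h using 1
  ext x y
  simp only [Matrix.sub_apply, Matrix.smul_apply, kroneckerMap_apply, traceOutLast, σB,
    Matrix.of_apply, Matrix.sum_apply, Matrix.submatrix_apply, smul_eq_mul, Finset.mul_sum,
    Finset.sum_sub_distrib]

/-! ### Asymptotics -/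

/-- The statistical part of the bound on the guessing probability. -/
def guessBound (m : ℕ) : ℝ :=
  (8 + 4 * Real.sqrt m) * (2 : ℝ) ^ (-(1 / 2 : ℝ) * Real.sqrt m)

theorem guessBound_pos (m : ℕ) : 0 < guessBound m := by
  unfold guessBound
  positivity

theorem isSoftO_guessBound :
    IsSoftO guessBound fun m : ℕ => (2 : ℝ) ^ (-(1 / 2 : ℝ) * Real.sqrt (m : ℝ)) := by
  have hlog : 0 < Real.log 2 := Real.log_pos (by norm_num)
  refine ⟨1, IsBigO.of_bound (24 / Real.log 2) ?_⟩
  filter_upwards [eventually_ge_atTop 1] with m hm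
  have hm' : 1 ≤ Real.sqrt m := Real.one_le_sqrt.2 (by exact_mod_cast hm)
  have hg : 0 < (2 : ℝ) ^ (-(1 / 2 : ℝ) * Real.sqrt m) := by positivity
  rw [Real.log_rpow (by norm_num), pow_one, Real.norm_eq_abs, Real.norm_eq_abs,
    abs_of_pos (guessBound_pos m), abs_mul, abs_of_pos hg, abs_abs,
    show -(1 / 2 : ℝ) * Real.sqrt m * Real.log 2 = -(1 / 2 * Real.sqrt m * Real.log 2) by ring,
    abs_neg, abs_of_pos (by positivity), guessBound]
  have e : 24 / Real.log 2 * ((2 : ℝ) ^ (-(1 / 2 : ℝ) * Real.sqrt m) *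
      (1 / 2 * Real.sqrt m * Real.log 2)) =
      (12 * Real.sqrt m) * (2 : ℝ) ^ (-(1 / 2 : ℝ) * Real.sqrt m) := by
    field_simp
    ring
  rw [e]
  exact mul_le_mul_of_nonneg_right (by linarith) hg.le

/-- The choice `t² = 2^{-⌊√m⌋/2}` balances the two weights of the Cauchy-Schwarz inequality. -/
theorem trace_bound_le {m : ℕ} {P η : ℝ} (hP : P ≤ (1 / 2 : ℝ) ^ Nat.sqrt m + η) (hη : η ≤ 1)
    {t : ℝ} (ht : t ^ 2 = (2 : ℝ) ^ (-(1 / 2 : ℝ) * (Nat.sqrt m : ℝ))) :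
    (1 + t ^ 2) * P + (1 + (t ^ 2)⁻¹) * (Nat.sqrt m * (1 / 2 : ℝ) ^ Nat.sqrt m) + (2 ^ m)⁻¹ ≤
      guessBound m + η := by
  set s := Nat.sqrt m with hs
  set ε := (2 : ℝ) ^ (-(1 / 2 : ℝ) * (s : ℝ)) with hε
  have hε0 : 0 < ε := by positivity
  have hεε : (1 / 2 : ℝ) ^ s = ε * ε := by
    rw [hε, ← Real.rpow_add (by norm_num), one_div, inv_pow, ← Real.rpow_natCast,
      ← Real.rpow_neg (by norm_num)]
    congr 1
    ring
  have hε1 : ε ≤ 1 := Real.rpow_le_one_of_one_le_of_nonpos (by norm_num) (by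
    have : (0 : ℝ) ≤ s := Nat.cast_nonneg s
    linarith)
  have hm : ((2 : ℝ) ^ m)⁻¹ ≤ ε * ε := by
    rw [← hεε, one_div, inv_pow]
    exact inv_anti₀ (by positivity) (pow_le_pow_right₀ (by norm_num) (Nat.sqrt_le_self m))
  have hsm : (s : ℝ) ≤ Real.sqrt m := by
    apply Real.le_sqrt_of_sq_le
    rw [pow_two]
    exact_mod_cast Nat.sqrt_le m
  have hms : Real.sqrt m ≤ s + 1 := by
    rw [Real.sqrt_le_left (by positivity), pow_two]
    exact_mod_cast (Nat.lt_succ_sqrt m).le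
  have hεg : ε ≤ 2 * (2 : ℝ) ^ (-(1 / 2 : ℝ) * Real.sqrt m) := by
    have : (2 : ℝ) * (2 : ℝ) ^ (-(1 / 2 : ℝ) * Real.sqrt m) =
        (2 : ℝ) ^ (1 + -(1 / 2 : ℝ) * Real.sqrt m) := by
      rw [Real.rpow_add (by norm_num), Real.rpow_one]
    rw [this, hε]
    exact Real.rpow_le_rpow_of_exponent_le (by norm_num) (by linarith)
  have hs0 : (0 : ℝ) ≤ s := Nat.cast_nonneg s
  rw [ht, hεε]
  rw [hεε] at hP
  have h1 : (1 + ε) * P ≤ (1 + ε) * (ε * ε + η) :=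
    mul_le_mul_of_nonneg_left hP (by positivity)
  have h2 : (1 + ε⁻¹) * (s * (ε * ε)) = s * (ε * ε) + s * ε := by
    field_simp
  have h3 : ε * ε ≤ ε := by nlinarith
  have h4 : ε * (ε * ε) ≤ ε * ε := by nlinarith [mul_pos hε0 hε0]
  have h5 : (s : ℝ) * (ε * ε) ≤ s * ε := mul_le_mul_of_nonneg_left h3 hs0
  have h6 : ε * η ≤ ε := by nlinarith
  have h7 : (4 + 2 * (s : ℝ)) * ε ≤ guessBound m := by
    calc (4 + 2 * (s : ℝ)) * ε ≤ (4 + 2 * Real.sqrt m) *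
          (2 * (2 : ℝ) ^ (-(1 / 2 : ℝ) * Real.sqrt m)) := by gcongr
      _ = guessBound m := by rw [guessBound]; ring
  nlinarith

theorem eventually_guessBound_le {n : ℕ → ℕ}
    (hn : (fun l : ℕ => Real.log (l : ℝ) ^ 2) =o[atTop] (fun l : ℕ => (n l : ℝ))) (K : ℕ) :
    ∀ᶠ l : ℕ in atTop, guessBound (n l) ≤ 1 / 2 * ((l : ℝ) ^ K)⁻¹ := by
  have hlog2 : 0 < Real.log 2 := Real.log_pos (by norm_num)
  have hloglim : Tendsto (fun l : ℕ => Real.log (l : ℝ)) atTop atTop :=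
    Real.tendsto_log_atTop.comp tendsto_natCast_atTop_atTop
  -- `√n` grows faster than any multiple of `log`
  have hsqrt : ∀ M : ℝ, 0 < M → ∀ᶠ l : ℕ in atTop, M * Real.log l ≤ Real.sqrt (n l) := by
    intro M hM
    have h := hn.def (c := (M ^ 2)⁻¹) (by positivity)
    filter_upwards [h, hloglim.eventually_ge_atTop 0] with l hl hl0
    apply Real.le_sqrt_of_sq_le
    rw [Real.norm_eq_abs, Real.norm_eq_abs, abs_of_nonneg (by positivity),
      abs_of_nonneg (by positivity), inv_mul_eq_div, le_div_iff₀ (by positivity)] at hl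
    calc (M * Real.log l) ^ 2 = Real.log l ^ 2 * M ^ 2 := by ring
      _ ≤ (n l : ℝ) := hl
  have hlim : Tendsto (fun l : ℕ => Real.sqrt (n l)) atTop atTop := by
    refine tendsto_atTop_mono' _ ?_ hloglim
    filter_upwards [hsqrt 1 one_pos] with l hl
    simpa using hl
  have hexp := (isLittleO_pow_exp_pos_mul_atTop 1 (b := Real.log 2 / 4) (by positivity)).def
    (c := 1 / 24) (by norm_num)
  filter_upwards [hlim.eventually hexp, hlim.eventually_ge_atTop 1,
    hsqrt (4 * (K + 1) / Real.log 2) (by positivity), hloglim.eventually_ge_atTop 0,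
    eventually_ge_atTop 1] with l h1 h2 h3 h4 h5
  set x := Real.sqrt (n l) with hx
  have hl : (0 : ℝ) < l := by exact_mod_cast h5
  rw [pow_one, Real.norm_eq_abs, Real.norm_eq_abs, abs_of_pos (by linarith), Real.abs_exp] at h1
  have e1 : (2 : ℝ) ^ (-(1 / 2 : ℝ) * x) =
      Real.exp (-(Real.log 2 / 4 * x)) * Real.exp (-(Real.log 2 / 4 * x)) := by
    rw [Real.rpow_def_of_pos (by norm_num), ← Real.exp_add]
    congr 1
    ring
  have e2 : Real.exp (-(Real.log 2 / 4 * x)) ≤ ((l : ℝ) ^ K)⁻¹ := by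
    rw [Real.exp_neg]
    apply inv_anti₀ (by positivity)
    rw [← Real.exp_log (pow_pos hl K), Real.log_pow]
    apply Real.exp_le_exp.2
    have h6 : Real.log 2 / 4 * (4 * (K + 1) / Real.log 2 * Real.log l) = (K + 1) * Real.log l := by
      field_simp
    have h7 := mul_le_mul_of_nonneg_left h3 (show 0 ≤ Real.log 2 / 4 by positivity)
    rw [h6] at h7
    linarith
  have e3 : (8 + 4 * x) * Real.exp (-(Real.log 2 / 4 * x)) ≤ 1 / 2 := by
    rw [Real.exp_neg, ← div_eq_mul_inv, div_le_iff₀ (Real.exp_pos _)]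
    linarith
  rw [guessBound, ← hx, e1, ← mul_assoc]
  exact mul_le_mul e3 e2 (Real.exp_pos _).le (by norm_num)

theorem eventually_le_neg_logb {n : ℕ → ℕ} {η : ℕ → ℝ}
    (hn : (fun l : ℕ => Real.log (l : ℝ) ^ 2) =o[atTop] (fun l : ℕ => (n l : ℝ)))
    (hη : Negligible η) (hpos : ∀ᶠ l in atTop, 0 < guessBound (n l) + η l) (a : ℝ) :
    ∀ᶠ l : ℕ in atTop, a * Real.log (l : ℝ) ≤ -Real.logb 2 (guessBound (n l) + η l) := by
  obtain ⟨K, hK⟩ := exists_nat_ge a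
  have h := (hη K).eventually_le_const (show (0 : ℝ) < 1 / 2 by norm_num)
  filter_upwards [h, eventually_guessBound_le hn K, hpos, eventually_ge_atTop 1]
    with l h1 h2 h3 h4
  have hl : (1 : ℝ) ≤ l := by exact_mod_cast h4
  have hl0 : (0 : ℝ) < (l : ℝ) ^ K := by positivity
  have hη' : η l ≤ 1 / 2 * ((l : ℝ) ^ K)⁻¹ := by
    rw [← div_eq_mul_inv, le_div_iff₀ hl0]
    linarith
  have hsum : guessBound (n l) + η l ≤ ((l : ℝ) ^ K)⁻¹ := by linarith
  have hlog2 : 0 < Real.log 2 := Real.log_pos (by norm_num)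
  have hlog2' : Real.log 2 ≤ 1 := by
    have := Real.log_two_lt_d9
    linarith
  have hlog : 0 ≤ Real.log l := Real.log_nonneg hl
  have h5 := Real.log_le_log h3 hsum
  rw [Real.log_inv, Real.log_pow] at h5
  rw [Real.logb, ← neg_div, le_div_iff₀ hlog2]
  have hK0 : (0 : ℝ) ≤ K := Nat.cast_nonneg K
  have h6 : a * Real.log l * Real.log 2 ≤ K * Real.log l * Real.log 2 := by gcongr
  have h7 : K * Real.log l * Real.log 2 ≤ K * Real.log l * 1 := by gcongr
  linarith

theorem Negligible.eventually_le_one {η : ℕ → ℝ} (hη : Negligible η) :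
    ∀ᶠ l in atTop, η l ≤ 1 := by
  have h := (hη 0).eventually_le_const (show (0 : ℝ) < 1 by norm_num)
  filter_upwards [h] with l hl
  simpa using hl

end CompMoE

end

theorem theorem3p2 :
    ∃ f : ℕ → ℝ, (∀ m, 0 < f m) ∧
      CompMoE.IsSoftO f (fun m : ℕ => (2 : ℝ) ^ (-(1 / 2 : ℝ) * Real.sqrt (m : ℝ))) ∧
      ∀ (q n : ℕ → ℕ)
        (Z : ∀ l : ℕ, PMF (CompMoE.Bits (Fin (q l)) × CompMoE.Bits (Fin (n l))))
        (η : ℕ → ℝ),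
        CompMoE.PolyBounded q → CompMoE.PolyBounded n →
        (fun l : ℕ => Real.log (l : ℝ) ^ 2) =o[atTop] (fun l : ℕ => (n l : ℝ)) →
        CompMoE.StronglyHidden Z η →
        ∀ (c : ℕ → ℕ) (prep : CompMoE.Preparation q n c),
          (∃ l₀ : ℕ, ∀ l : ℕ, l₀ ≤ l →
            CompMoE.condMinEntropy (CompMoE.gameKCT Z prep l) ≤
              CompMoE.condMinEntropy (CompMoE.gameKC Z prep l) ∧
            ((-Real.logb 2 (f (n l) + η l) : ℝ) : EReal) ≤
              CompMoE.condMinEntropy (CompMoE.gameKCT Z prep l)) ∧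
          (∀ a : ℝ, ∀ᶠ l : ℕ in atTop,
            ((a * Real.log (l : ℝ) : ℝ) : EReal) ≤
              CompMoE.condMinEntropy (CompMoE.gameKC Z prep l)) := by
  refine ⟨CompMoE.guessBound, CompMoE.guessBound_pos, CompMoE.isSoftO_guessBound, ?_⟩
  intro q n Z η _ hn hlog hZ c prep
  have hmain : ∀ᶠ l : ℕ in atTop, 0 < CompMoE.guessBound (n l) + η l ∧
      ((-Real.logb 2 (CompMoE.guessBound (n l) + η l) : ℝ) : EReal) ≤
        CompMoE.condMinEntropy (CompMoE.gameKCT Z prep l) := by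
    obtain ⟨l₀, hl₀⟩ := CompMoE.eventually_testProb_le hn hZ prep
    filter_upwards [hZ.1.eventually_le_one, eventually_ge_atTop l₀] with l hη hl
    have hε : (0 : ℝ) < (2 : ℝ) ^ (-(1 / 2 : ℝ) * (Nat.sqrt (n l) : ℝ)) := by positivity
    obtain ⟨ω, hω, htr, hle⟩ := CompMoE.exists_stateKCT_le (Z l) (prep.state l)
      (fun p => CompMoE.QPT.run_isDensity prep l (CompMoE.single_isDensity p))
      (Real.sqrt_pos.2 hε)
    have hb := CompMoE.trace_bound_le (hl₀ l hl) hη (Real.sq_sqrt hε.le)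
    have hP : 0 ≤ ∑ x, (Z l x).toReal * CompMoE.testProb (prep.state l x.1) x.2 :=
      Finset.sum_nonneg fun x _ => mul_nonneg ENNReal.toReal_nonneg
        (CompMoE.testProb_nonneg (CompMoE.QPT.run_isDensity prep l (CompMoE.single_isDensity x.1)) _)
    refine ⟨lt_of_lt_of_le (by positivity) hb, CompMoE.le_condMinEntropy hω htr ?_ hb hle⟩
    positivity
  constructor
  · obtain ⟨l₀, hl₀⟩ := eventually_atTop.1 hmain
    exact ⟨l₀, fun l hl => ⟨CompMoE.condMinEntropy_le_traceOutLast _, (hl₀ l hl).2⟩⟩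
  · intro a
    filter_upwards [hmain, CompMoE.eventually_le_neg_logb hlog hZ.1
      (hmain.mono fun l h => h.1) a] with l h1 h2
    exact (EReal.coe_le_coe_iff.2 h2).trans
      (h1.2.trans (CompMoE.condMinEntropy_le_traceOutLast _))
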